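/- **Market.** Let $A$ be a finite nonempty set of agents. The goods are bread (good $0$) and digital categories $1,\dots,g$ ($g\ge 0$). Category $j\ge 1$ starts with a finite nonempty set $S_j$ of initial songs, each owned by exactly one agent. Each agent $i$ has a compact convex set $P_i\subset\mathbb R_+^{g+1}$ of feasible productions containing a point with positive bread production; a coarse utility $f_i:\mathbb R_+^{g+1}\to\mathbb R_+$ that is continuous, quasi-concave and non-satiated in every good (more of any good is strictly better); and, for each $j\ge1$, a strict total order $T_{ij}$ on the sources $A\cup S_j$ (agents as producers of songs, and initial songs). Given productions $y$, source $k$ offers $y_{kj}$ songs, with $y_{kj}=1$ for $k\in S_j$; put $Y_j=\sum_{k\in A\cup S_j}y_{kj}$. An allocation $x$ specifies quantities $x_{ij}$ for all goods $j\ge 0$ and, for $j\ge1$, the quantity $x_{ijk}$ that $i$ obtains from source $k$. For $j\ge 1$ let $R_{ij}(k)=\max\{0,\ x_{ij}-\sum_{k' \text{ above } k \text{ in } T_{ij}}y_{k'j}\}$. The earnings of $i$ at $(p,x,y)$ are $$p_0y_{i0}+\sum_{j\ge1}p_j\Big(\sum_{k\in S_j \text{ owned by } i}\ \sum_{b\in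 A}x_{bjk}+\sum_{b\in A}x_{bji}\Big).$$ A production $v\in P_i$ is *optimal* for $i$ at $(p,x,y)$ if it maximizes over $P_i$ $$p_0v_0+\sum_{j\ge1}p_j\Big(\sum_{k\in S_j\text{ owned by }i}\ \sum_{b\in A}x_{bjk}+\sum_{b\in A}\min\{v_j,R_{bj}(i)\}\Big)$$ (this depends only on $p$, $x$ and the productions of the others). An allocation of agent $i$ is an *optimal detailed allocation* for prices $p$, money $w$ and productions $y$ if $(x_{ij})_{j\ge0}\in\mathbb R_+^{g+1}$ maximizes $f_i(z)$ over $z\in\mathbb R_+^{g+1}$ with $\sum_j p_jz_j\le w$, and $x_{ijk}=\min\{y_{kj},R_{ij}(k)\}$ for all $j\ge 1$ and $k$ (songs are taken in the order $T_{ij}$). **Equilibrium.** $(p,x,y)$ with $p\ge0$ is an equilibrium if (1) each $y_i$ is an optimal production of $i$ at $(p,x,y)$; (2) each $x_i$ is an optimal detailed allocation for prices $p$, the money earned by $i$ at $(p,x,y)$, and productions $y$; (3) the market clears: $\sum_i x_{i0}=\sum_i y_{i0}$; for every $j\ge 1$ with $p_j>0$ and every $k\in A\cup S_j$ some agent $i$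 has $x_{ijk}=y_{kj}$; and $x_{ij}\le Y_j$ for all $i$ and all $j\ge1$. **Correspondence.** Let $M$ be such that $\sum_iy_{i0}\le M$ and $Y_j\le M$ ($j\ge1$) for all feasible productions $y$. Let $D=[0,1.1M]$ and let $\Delta_g\subset\mathbb R^{g+1}$ be the unit simplex. Put $b(j)=\sum_ix_{ij}$ for $j\ge 0$, $s(0)=\sum_iy_{i0}$, and $s(j)=\sum_{k\in A\cup S_j}\big(y_{kj}-\max_ix_{ijk}+\sum_ix_{ijk}\big)$ for $j\ge1$. Then $(p',x',y')\in F(p,x,y)$ iff $p'\in\Delta_g$; all coordinates of $x'$ and $y'$ lie in $D$; for each $i$, $x'_i$ is an optimal detailed allocation for prices $p$, the money earned by $i$ at $(p,x,y)$, and productions $y$, with $f_i$ replaced by its flattening $z\mapsto f_i\big((\min\{z_j,1.1M\})_j\big)$; for each $i$, $y'_i$ is an optimal production of $i$ at $(p,x,y)$; and $$p'\in\operatorname*{argmax}_{q\in\Delta_g}\Big\{q_0\frac{b(0)+1}{s(0)+1}+\sum_{j=1}^gq_j\frac{b(j)}{s(j)}\Big\}.$$ **Theorem.** For every such $M$ and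 every triple $(p,x,y)$ one has $(p,x,y)\in F(p,x,y)$ if and only if $p\in\Delta_g$ and $(p,x,y)$ is an equilibrium of the market. Moreover, every such market has an equilibrium $(p,x,y)$ with $p\in\Delta_g$. -/

import Mathlib

/-!
A mixed market with one conventional good ("bread") and finitely many digital categories.

Agents form the type `A`, digital categories the type `J`, and `S j` is the set of initial songs of
category `j`. Goods are `Option J`: `none` is bread, `some j` is category `j`. The sources of songs
in category `j` are `A ⊕ S j`: `Sum.inl i` stands for the songs produced by agent `i`,
`Sum.inr k` for the initial song `k`.
-/

open scoped BigOperators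

/-- The primitives of the market, with the standing assumptions on them. -/
structure DigitalMarket (A J : Type*) (S : J → Type*) [Fintype A] [Fintype J] where
  /-- Each initial song has a unique owner. -/
  owner : ∀ j, S j → A
  /-- The set of feasible production points of each agent. -/
  feasible : A → Set (Option J → ℝ)
  feasible_nonneg : ∀ i, ∀ y ∈ feasible i, 0 ≤ y
  feasible_compact : ∀ i, IsCompact (feasible i)
  feasible_convex : ∀ i, Convex ℝ (feasible i)
  /-- Every agent has the option of producing a positive amount of bread. -/
  feasible_bread : ∀ i, ∃ y ∈ feasible i, 0 < y none
  /-- The coarse utility functions, considered on the nonnegative orthant only. -/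
  utility : A → (Option J → ℝ) → ℝ
  utility_nonneg : ∀ i, ∀ z, 0 ≤ z → 0 ≤ utility i z
  utility_continuous : ∀ i, ContinuousOn (utility i) (Set.Ici 0)
  utility_quasiconcave : ∀ i, QuasiconcaveOn ℝ (Set.Ici 0) (utility i)
  /-- Non-satiation in every good: more of any good is strictly better. -/
  utility_nonsatiated : ∀ i, StrictMonoOn (utility i) (Set.Ici 0)
  /-- `prefers i j k k'`: in category `j`, agent `i` ranks the source `k` above the source `k'`. -/
  prefers : A → ∀ j, A ⊕ S j → A ⊕ S j → Prop
  prefers_total : ∀ i j, IsStrictTotalOrder (A ⊕ S j) (prefers i j)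

/-- Prices, detailed allocations and productions. The allocation consists of the quantity
`amount i c` of every good that agent `i` obtains, and of the part `detail i j k` of the quantity
`amount i (some j)` that comes from the source `k`. (If `amount i (some j)` exceeds the number of
available songs, the `detail i j k` do not add up to it; the difference is excess demand.) -/
@[ext]
structure MarketState (A J : Type*) (S : J → Type*) where
  price : Option J → ℝ
  amount : A → Option J → ℝ
  detail : A → ∀ j, A ⊕ S j → ℝ
  production : A → Option J → ℝ

namespace DigitalMarket

noncomputable section

open scoped Classical

variable {A J : Type*} {S : J → Type*} [Fintype A] [Fintype J] [∀ j, Fintype (S j)]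

/-- The number of songs available from a source: what the agent produces, or one initial song. -/
def available (y : A → Option J → ℝ) (j : J) : A ⊕ S j → ℝ
  | Sum.inl i => y i (some j)
  | Sum.inr _ => 1

/-- The total number of songs available in category `j`. -/
def totalAvailable (S : J → Type*) [∀ j, Fintype (S j)] (y : A → Option J → ℝ) (j : J) : ℝ :=
  ∑ k : A ⊕ S j, available y j k

/-- If agent `i` is to obtain `q` songs of category `j`, this is the part of `q` left over
after all sources that `i` ranks above `k` have been used up. -/
def residual (m : DigitalMarket A J S) (y : A → Option J → ℝ) (i : A) (j : J) (q : ℝ)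
    (k : A ⊕ S j) : ℝ :=
  max 0 (q - ∑ k' : A ⊕ S j with m.prefers i j k' k, available y j k')

/-- Coarse bundle `z` is optimal for the utility `u` at prices `p` with the amount `w` of money. -/
def IsOptimalBundle (u : (Option J → ℝ) → ℝ) (p : Option J → ℝ) (w : ℝ)
    (z : Option J → ℝ) : Prop :=
  0 ≤ z ∧ ∑ c, p c * z c ≤ w ∧
    ∀ z' : Option J → ℝ, 0 ≤ z' → ∑ c, p c * z' c ≤ w → u z' ≤ u z

/-- `(z, x)` is an optimal detailed allocation of agent `i`: the coarse allocation `z` is optimal,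
and in every category the songs are taken in the order of `i`'s ranking. -/
def IsOptimalDetailed (m : DigitalMarket A J S) (u : (Option J → ℝ) → ℝ) (p : Option J → ℝ)
    (w : ℝ) (y : A → Option J → ℝ) (i : A) (z : Option J → ℝ) (x : ∀ j, A ⊕ S j → ℝ) : Prop :=
  IsOptimalBundle u p w z ∧
    ∀ j k, x j k = min (available y j k) (m.residual y i j (z (some j)) k)

/-- The number of copies of initial songs of category `j` owned by `i` that are sold. -/
def ownedSales (m : DigitalMarket A J S) (x : A → ∀ j, A ⊕ S j → ℝ) (i : A) (j : J) : ℝ :=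
  ∑ k : S j with m.owner j k = i, ∑ b : A, x b j (Sum.inr k)

/-- The earnings of agent `i`: from her bread, and from all copies sold of songs that she owns
or produces. -/
def earnings (m : DigitalMarket A J S) (e : MarketState A J S) (i : A) : ℝ :=
  e.price none * e.production i none +
    ∑ j, e.price (some j) * (m.ownedSales e.detail i j + ∑ b : A, e.detail b j (Sum.inl i))

/-- The earnings of agent `i` if she produces `v`, given prices, allocations and the digital
production of the other agents: the sales of the initial songs are those of the given allocation,
and buyer `b` buys the songs produced by `i` up to what is left of `b`'s quantity after the sources
that `b` ranks above `i` (`residual` at `Sum.inl i` does not depend on `i`'s own production). -/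
def potentialEarnings (m : DigitalMarket A J S) (e : MarketState A J S) (i : A)
    (v : Option J → ℝ) : ℝ :=
  e.price none * v none +
    ∑ j, e.price (some j) * (m.ownedSales e.detail i j +
      ∑ b : A, min (v (some j)) (m.residual e.production b j (e.amount b (some j)) (Sum.inl i)))

/-- `v` is an optimal production of agent `i`. -/
def IsOptimalProduction (m : DigitalMarket A J S) (e : MarketState A J S) (i : A)
    (v : Option J → ℝ) : Prop :=
  v ∈ m.feasible i ∧
    ∀ v' ∈ m.feasible i, m.potentialEarnings e i v' ≤ m.potentialEarnings e i v

/-- Market clearing. -/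
def MarketClears (e : MarketState A J S) : Prop :=
  (∑ i, e.amount i none = ∑ i, e.production i none) ∧
  (∀ j, 0 < e.price (some j) →
    ∀ k : A ⊕ S j, ∃ i, e.detail i j k = available e.production j k) ∧
  (∀ i j, e.amount i (some j) ≤ totalAvailable S e.production j)

/-- Equilibrium of the market. -/
structure IsEquilibrium (m : DigitalMarket A J S) (e : MarketState A J S) : Prop where
  price_nonneg : 0 ≤ e.price
  optimal_production : ∀ i, m.IsOptimalProduction e i (e.production i)
  optimal_allocation : ∀ i,
    m.IsOptimalDetailed (m.utility i) e.price (m.earnings e i) e.production i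
      (e.amount i) (e.detail i)
  clears : MarketClears e

/-- `M` bounds the number of units of bread, and the number of songs of each category (initial
songs included), that can ever be available. -/
def IsSupplyBound (m : DigitalMarket A J S) (M : ℝ) : Prop :=
  ∀ y : A → Option J → ℝ, (∀ i, y i ∈ m.feasible i) →
    ∑ i, y i none ≤ M ∧ ∀ j, totalAvailable S y j ≤ M

/-- The utility of agent `i`, flattened out in every good after `1.1 M` units. -/
def flatUtility (m : DigitalMarket A J S) (M : ℝ) (i : A) (z : Option J → ℝ) : ℝ :=
  m.utility i (fun c => min (z c) (1.1 * M))

/-- Excess supply of the source `k` in category `j`. -/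
def excessSupply (e : MarketState A J S) (j : J) (k : A ⊕ S j) : ℝ :=
  available e.production j k - ⨆ i, e.detail i j k

/-- The number of units bought of each good. -/
def bought (e : MarketState A J S) (c : Option J) : ℝ :=
  ∑ i, e.amount i c

/-- The number of units sold of each good (for digital categories, excess supply being bought by
a fictitious market maker). -/
def sold (e : MarketState A J S) : Option J → ℝ
  | none => ∑ i, e.production i none
  | some j => ∑ k : A ⊕ S j, (excessSupply e j k + ∑ i, e.detail i j k)

/-- The objective maximized in the price update. -/
def priceObjective (e : MarketState A J S) (q : Option J → ℝ) : ℝ :=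
  q none * ((bought e none + 1) / (sold e none + 1)) +
    ∑ j, q (some j) * (bought e (some j) / sold e (some j))

/-- The domain of the correspondence. -/
def domain (S : J → Type*) (M : ℝ) : Set (MarketState A J S) :=
  {e | e.price ∈ stdSimplex ℝ (Option J) ∧
    (∀ i c, e.amount i c ∈ Set.Icc 0 (1.1 * M)) ∧
    (∀ i j k, e.detail i j k ∈ Set.Icc 0 (1.1 * M)) ∧
    (∀ i c, e.production i c ∈ Set.Icc 0 (1.1 * M))}

/-- The correspondence whose fixed points are studied. -/
def correspondence (m : DigitalMarket A J S) (M : ℝ) (e : MarketState A J S) :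
    Set (MarketState A J S) :=
  {e' | e' ∈ domain S M ∧
    (∀ i, m.IsOptimalDetailed (m.flatUtility M i) e.price (m.earnings e i) e.production i
      (e'.amount i) (e'.detail i)) ∧
    (∀ i, m.IsOptimalProduction e i (e'.production i)) ∧
    IsMaxOn (priceObjective e) (stdSimplex ℝ (Option J)) e'.price}

end

end DigitalMarket

/-!
At a fixed point, the prices maximize a linear functional over the simplex whose coefficients are
ratios of demand and supply. Goods with a positive price all have the largest ratio, and if that
ratio exceeded `1`, then the agents would together spend more than they earn. So no good is in
excess demand, no agent reaches the cap `1.1 * M`, and by quasi-concavity the flattening of the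
utilities is not felt. Conversely, when the market clears all ratios are equal to `1`.

For existence, demands are replaced by quasi-demands, which are only compared with bundles that
leave some money unspent: these have a closed graph even where earnings vanish. Details follow from
the quantities, so Kakutani's theorem applies to prices, quantities and productions. The `1` added
in the bread ratio makes that ratio positive; hence if bread were free, some category with a
positive price would be bought, and its sellers, having money, would ask for unlimited amounts of
bread. So bread has a positive price, everybody has earnings, and quasi-demands are demands.

Kakutani's theorem is derived from a covering theorem for the simplex. The latter comes from
Scarf's lemma, a parity count of almost completely colored dominant sets, applied to finer and finer
grids.
-/

namespace Scarf

open scoped Classical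

section Completions

variable {I Y R : Type*} [LinearOrder R] {r : I → Y → R} {σ τ : Finset Y} {l : I → Y}
  {d d' : I} {x x' y : Y}

/-- Dominance, for rankings `r i` of the points of `Y`: no point lies, in every ranking, strictly
above the lowest point of `σ`. -/
def Dominant (r : I → Y → R) (σ : Finset Y) : Prop :=
  ∀ y, ∃ i, ∀ x ∈ σ, r i y ≤ r i x

/-- `y` lies above the lowest point of `τ` in every ranking other than `d`. -/
def Beats (r : I → Y → R) (τ : Finset Y) (d : I) (y : Y) : Prop :=
  ∀ i, i ≠ d → ∃ x ∈ τ, r i x < r i y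

/-- `x` is the `d`-highest among the points that beat `τ` in all rankings other than `d`. -/
def IsTop (r : I → Y → R) (τ : Finset Y) (d : I) (x : Y) : Prop :=
  Beats r τ d x ∧ ∀ y, Beats r τ d y → r d y ≤ r d x

/-- `l i` is the lowest point of `σ` in the ranking `i`, for every `i`. -/
def IsLowest (r : I → Y → R) (σ : Finset Y) (l : I → Y) : Prop :=
  ∀ i, l i ∈ σ ∧ ∀ x ∈ σ, r i (l i) ≤ r i x

lemma Dominant.mono (h : Dominant r σ) (hτ : τ ⊆ σ) : Dominant r τ :=
  fun y => (h y).imp fun _ hi x hx => hi x (hτ hx)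

lemma IsTop.unique (hr : ∀ i, Function.Injective (r i)) (h : IsTop r τ d x)
    (h' : IsTop r τ d x') : x = x' :=
  hr d (le_antisymm (h'.2 x h.1) (h.2 x' h'.1))

lemma exists_isTop [Finite Y] (h : ∃ y, Beats r τ d y) : ∃ x, IsTop r τ d x :=
  Set.exists_max_image {y | Beats r τ d y} (r d) (Set.toFinite _) h

lemma exists_isLowest (r : I → Y → R) (hσ : σ.Nonempty) : ∃ l, IsLowest r σ l := by
  choose l hl using fun i => Finset.exists_min_image σ (r i) hσ
  exact ⟨l, hl⟩

lemma Dominant.le_of_beats (hτ : Dominant r τ) (hy : Beats r τ d y) (hx : x ∈ τ) :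
    r d y ≤ r d x := by
  obtain ⟨i, hi⟩ := hτ y
  rcases eq_or_ne i d with rfl | hid
  · exact hi x hx
  · obtain ⟨z, hz, hlt⟩ := hy i hid
    exact absurd (hi z hz) hlt.not_ge

lemma Dominant.exists_lowest_eq (hr : ∀ i, Function.Injective (r i)) (hσ : Dominant r σ)
    (hl : IsLowest r σ l) (hx : x ∈ σ) : ∃ i, l i = x := by
  obtain ⟨i, hi⟩ := hσ x
  exact ⟨i, hr i (le_antisymm ((hl i).2 x hx) (hi _ (hl i).1))⟩

lemma Dominant.lowest_injective [Fintype I] (hr : ∀ i, Function.Injective (r i))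
    (hσ : Dominant r σ) (hl : IsLowest r σ l) (hcard : σ.card = Fintype.card I) :
    Function.Injective l := by
  have hsurj : Set.SurjOn l (Finset.univ : Finset I) σ := fun x hx =>
    (hσ.exists_lowest_eq hr hl hx).imp fun i hi => ⟨Finset.mem_coe.2 (Finset.mem_univ i), hi⟩
  simpa [Set.injOn_univ] using Finset.injOn_of_surjOn_of_card_le l (fun i _ => (hl i).1) hsurj
    (by rw [hcard, Finset.card_univ])

variable [DecidableEq Y]

/-- Adding the new point `x` to `τ` produces a dominant set. -/
def IsCompletion (r : I → Y → R) (τ : Finset Y) (x : Y) : Prop :=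
  x ∉ τ ∧ Dominant r (insert x τ)

lemma IsCompletion.exists_isTop [Fintype I] (hr : ∀ i, Function.Injective (r i))
    (hl : IsLowest r τ l) (hcard : τ.card + 1 = Fintype.card I) (h : IsCompletion r τ x) :
    ∃ d, IsTop r τ d x ∧ Set.InjOn l {d}ᶜ := by
  obtain ⟨hx, hdom⟩ := h
  obtain ⟨l', hl'⟩ := exists_isLowest r (Finset.insert_nonempty x τ)
  have hinj : Function.Injective l' :=
    hdom.lowest_injective hr hl' (by rw [Finset.card_insert_of_notMem hx, hcard])
  obtain ⟨d, hd⟩ := hdom.exists_lowest_eq hr hl' (Finset.mem_insert_self x τ)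
  have hmem : ∀ i ≠ d, l' i ∈ τ := fun i hi =>
    (Finset.mem_insert.1 (hl' i).1).resolve_left fun h => hi (hinj (h.trans hd.symm))
  have hbeats : Beats r τ d x := fun i hi =>
    ⟨l' i, hmem i hi, ((hl' i).2 x (Finset.mem_insert_self x τ)).lt_of_ne fun h =>
      hx (hr i h ▸ hmem i hi)⟩
  have hmax : ∀ y, Beats r τ d y → r d y ≤ r d x := fun y hy =>
    hdom.le_of_beats (fun i hi => (hy i hi).imp fun z hz => ⟨Finset.mem_insert_of_mem hz.1, hz.2⟩)
      (Finset.mem_insert_self x τ)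
  have hll' : Set.EqOn l' l {d}ᶜ := fun i hi =>
    hr i (le_antisymm ((hl' i).2 _ (Finset.mem_insert_of_mem (hl i).1))
      ((hl i).2 _ (hmem i hi)))
  exact ⟨d, ⟨hbeats, hmax⟩, hll'.injOn_iff.1 hinj.injOn⟩

lemma IsTop.isCompletion (hr : ∀ i, Function.Injective (r i)) (hτ : Dominant r τ)
    (hl : IsLowest r τ l) (hd : d ≠ d') (heq : l d = l d') (hx : IsTop r τ d x) :
    IsCompletion r τ x := by
  refine ⟨fun hxτ => ?_, fun y => ?_⟩
  · obtain ⟨i, hid, rfl⟩ : ∃ i, i ≠ d ∧ l i = x := by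
      obtain ⟨i, hi⟩ := hτ.exists_lowest_eq hr hl hxτ
      rcases eq_or_ne i d with rfl | hid
      · exact ⟨d', hd.symm, heq.symm.trans hi⟩
      · exact ⟨i, hid, hi⟩
    obtain ⟨z, hz, hlt⟩ := hx.1 i hid
    exact hlt.not_ge ((hl i).2 z hz)
  · by_cases hy : Beats r τ d y
    · exact ⟨d, Finset.forall_mem_insert .. |>.2 ⟨hx.2 y hy, fun z hz => hτ.le_of_beats hy hz⟩⟩
    · simp only [Beats, not_forall, not_exists, not_and, not_lt] at hy
      obtain ⟨i, hid, hi⟩ := hy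
      obtain ⟨w, hw, hlt⟩ := hx.1 i hid
      exact ⟨i, Finset.forall_mem_insert .. |>.2 ⟨(hi w hw).trans hlt.le, hi⟩⟩

/-- Among the `card I` lowest points of `τ`, exactly two coincide; a completion takes over the
role of the lowest point in one of these two rankings. -/
lemma exists_isCompletion_iff [Fintype I] (hr : ∀ i, Function.Injective (r i))
    (hne : τ.Nonempty) (hτ : Dominant r τ) (hcard : τ.card + 1 = Fintype.card I) :
    ∃ d₁ d₂, d₁ ≠ d₂ ∧ ∀ x, IsCompletion r τ x ↔ IsTop r τ d₁ x ∨ IsTop r τ d₂ x := by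
  obtain ⟨l, hl⟩ := exists_isLowest r hne
  obtain ⟨d₁, -, d₂, -, hd, heq⟩ := Finset.exists_ne_map_eq_of_card_lt_of_maps_to
    (s := Finset.univ) (by rw [Finset.card_univ]; omega) fun i _ => (hl i).1
  refine ⟨d₁, d₂, hd, fun x => ⟨fun hx => ?_, ?_⟩⟩
  · obtain ⟨d, htop, hinj⟩ := hx.exists_isTop hr hl hcard
    by_cases h₁ : d₁ = d
    · exact Or.inl (h₁ ▸ htop)
    · by_cases h₂ : d₂ = d
      · exact Or.inr (h₂ ▸ htop)
      · exact absurd (hinj h₁ h₂ heq) hd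
  · rintro (hx | hx)
    · exact hx.isCompletion hr hτ hl hd heq
    · exact hx.isCompletion hr hτ hl hd.symm heq.symm

lemma card_completions [Fintype I] [Fintype Y] (hr : ∀ i, Function.Injective (r i))
    (hne : τ.Nonempty) (hτ : Dominant r τ) (hcard : τ.card + 1 = Fintype.card I)
    (hbeats : ∀ d, ∃ y, Beats r τ d y) : (Finset.univ.filter (IsCompletion r τ)).card = 2 := by
  obtain ⟨d₁, d₂, hd, hiff⟩ := exists_isCompletion_iff hr hne hτ hcard
  obtain ⟨x₁, hx₁⟩ := exists_isTop (hbeats d₁)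
  obtain ⟨x₂, hx₂⟩ := exists_isTop (hbeats d₂)
  have hne : x₁ ≠ x₂ := by
    rintro rfl
    obtain ⟨z, hz, hlt⟩ := hx₂.1 d₁ hd
    exact hlt.not_ge (hτ.le_of_beats hx₁.1 hz)
  refine Finset.card_eq_two.2 ⟨x₁, x₂, hne, Finset.ext fun x => ?_⟩
  simp only [Finset.mem_filter, Finset.mem_univ, true_and, hiff, Finset.mem_insert,
    Finset.mem_singleton]
  refine or_congr ⟨fun h => h.unique hr hx₁, ?_⟩ ⟨fun h => h.unique hr hx₂, ?_⟩ <;>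
  · rintro rfl
    assumption

end Completions

section Parity

variable {I Y : Type*} [DecidableEq I] [DecidableEq Y] {c : Y → I} {σ : Finset Y} {x x' : Y}

lemma image_erase_eq_image (hx' : x' ∈ σ.erase x) (hc : c x' = c x) :
    (σ.erase x).image c = σ.image c := by
  refine (Finset.image_subset_image (Finset.erase_subset x σ)).antisymm fun i hi => ?_
  obtain ⟨w, hw, rfl⟩ := Finset.mem_image.1 hi
  rcases eq_or_ne w x with rfl | hwx
  · exact Finset.mem_image.2 ⟨x', hx', hc⟩
  · exact Finset.mem_image_of_mem c (Finset.mem_erase.2 ⟨hwx, hw⟩)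

variable [Fintype I]

/-- If some facet `σ.erase x` carries all colours but `i₀`, then `c x` occurs exactly once more in
`σ`, at `x'` say, and the other facet with this property is `σ.erase x'`. -/
lemma even_card_facets {i₀ : I} (hcard : σ.card = Fintype.card I)
    (hσ : σ.image c ≠ Finset.univ) :
    Even (σ.filter fun x => (σ.erase x).image c = Finset.univ.erase i₀).card := by
  rcases (σ.filter fun x => (σ.erase x).image c = Finset.univ.erase i₀).eq_empty_or_nonempty
    with hempty | ⟨x, hx⟩
  · simp [hempty]
  obtain ⟨hx, himg⟩ := Finset.mem_filter.1 hx
  have hinj : ∀ z ∈ σ, (σ.erase z).image c = Finset.univ.erase i₀ →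
      Set.InjOn c (σ.erase z) := fun z hz h => by
    rw [← Finset.card_image_iff, h, Finset.card_erase_of_mem hz,
      Finset.card_erase_of_mem (Finset.mem_univ _), Finset.card_univ, hcard]
  have hcx : c x ∈ (σ.erase x).image c := by
    rw [himg, Finset.mem_erase]
    refine ⟨fun h => hσ ?_, Finset.mem_univ _⟩
    rw [← Finset.insert_erase hx, Finset.image_insert, himg, h,
      Finset.insert_erase (Finset.mem_univ _)]
  obtain ⟨x', hx', hcx'⟩ := Finset.mem_image.1 hcx
  obtain ⟨hne, hx'σ⟩ := Finset.mem_erase.1 hx'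
  suffices h : (σ.filter fun x => (σ.erase x).image c = Finset.univ.erase i₀) = {x, x'} by
    rw [h, Finset.card_pair hne.symm]
    exact even_two
  ext z
  simp only [Finset.mem_filter, Finset.mem_insert, Finset.mem_singleton]
  constructor
  · rintro ⟨hz, himgz⟩
    by_contra! hzx
    exact hne (hinj z hz himgz (Finset.mem_erase.2 ⟨hzx.2.symm, hx'σ⟩)
      (Finset.mem_erase.2 ⟨hzx.1.symm, hx⟩) hcx')
  · rintro (rfl | rfl)
    · exact ⟨hx, himg⟩
    · refine ⟨hx'σ, ?_⟩
      rw [image_erase_eq_image (Finset.mem_erase.2 ⟨hne.symm, hx⟩) hcx'.symm,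
        ← image_erase_eq_image hx' hcx', himg]

variable {R : Type*} [LinearOrder R] {r : I → Y → R} {i₀ : I} {τ τ₀ : Finset Y}

/-- The cells of the pivoting argument. -/
def IsRoom (r : I → Y → R) (σ : Finset Y) : Prop :=
  σ.card = Fintype.card I ∧ Dominant r σ

/-- The facets between cells that carry all colours other than `i₀`. -/
def IsDoor (r : I → Y → R) (c : Y → I) (i₀ : I) (τ : Finset Y) : Prop :=
  τ.card + 1 = Fintype.card I ∧ Dominant r τ ∧ τ.image c = Finset.univ.erase i₀

variable [Fintype Y]

lemma sum_card_completions_eq_sum_card_facets :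
    ∑ τ with IsDoor r c i₀ τ, (Finset.univ.filter (IsCompletion r τ)).card =
      ∑ σ with IsRoom r σ,
        (σ.filter fun x => (σ.erase x).image c = Finset.univ.erase i₀).card := by
  simp only [← Finset.card_sigma]
  refine Finset.card_nbij' (fun q => ⟨insert q.2 q.1, q.2⟩) (fun q => ⟨q.1.erase q.2, q.2⟩)
    ?_ ?_ ?_ ?_
  · rintro ⟨τ, x⟩ h
    simp only [Finset.coe_sigma, Set.mem_sigma_iff, Finset.mem_coe, Finset.mem_filter,
      Finset.mem_univ, true_and] at h ⊢
    obtain ⟨⟨hcard, -, himg⟩, hx, hdom⟩ := h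
    exact ⟨⟨by rw [Finset.card_insert_of_notMem hx, hcard], hdom⟩,
      Finset.mem_insert_self x τ, by rw [Finset.erase_insert hx, himg]⟩
  · rintro ⟨σ, x⟩ h
    simp only [Finset.coe_sigma, Set.mem_sigma_iff, Finset.mem_coe, Finset.mem_filter,
      Finset.mem_univ, true_and] at h ⊢
    obtain ⟨⟨hcard, hdom⟩, hx, himg⟩ := h
    exact ⟨⟨by rw [Finset.card_erase_add_one hx, hcard], hdom.mono (Finset.erase_subset x σ),
      himg⟩, Finset.notMem_erase x σ, by rwa [Finset.insert_erase hx]⟩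
  · rintro ⟨τ, x⟩ h
    simp only [Finset.coe_sigma, Set.mem_sigma_iff, Finset.mem_coe, Finset.mem_filter] at h
    simp only [Finset.erase_insert h.2.2.1]
  · rintro ⟨σ, x⟩ h
    simp only [Finset.coe_sigma, Set.mem_sigma_iff, Finset.mem_coe, Finset.mem_filter] at h
    simp only [Finset.insert_erase h.2.1]

/-- If no room carried all colours, then every room would have an even number of doors, whereas
all doors but one lead into two rooms. -/
theorem exists_isRoom_image_eq_univ (hdoor : IsDoor r c i₀ τ₀)
    (hone : (Finset.univ.filter (IsCompletion r τ₀)).card = 1)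
    (htwo : ∀ τ, IsDoor r c i₀ τ → τ ≠ τ₀ →
      (Finset.univ.filter (IsCompletion r τ)).card = 2) :
    ∃ σ, IsRoom r σ ∧ σ.image c = Finset.univ := by
  by_contra! hno
  have heven : Even (∑ τ with IsDoor r c i₀ τ, (Finset.univ.filter (IsCompletion r τ)).card) := by
    rw [sum_card_completions_eq_sum_card_facets]
    refine Finset.even_sum _ fun σ hσ => ?_
    have hroom := (Finset.mem_filter.1 hσ).2
    exact even_card_facets hroom.1 (hno σ hroom)
  rw [← Finset.add_sum_erase _ _ (Finset.mem_filter.2 ⟨Finset.mem_univ τ₀, hdoor⟩), hone,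
    add_comm] at heven
  refine Nat.not_even_iff_odd.2 (Even.add_one (Finset.even_sum _ fun τ hτ => ?_)) heven
  obtain ⟨hne, hτ⟩ := Finset.mem_erase.1 hτ
  rw [htwo τ (Finset.mem_filter.1 hτ).2 hne]
  exact even_two

end Parity

section Dummies

variable {I X R : Type*} [Fintype I] {ρ : I → X → R}

/-- The rankings extended to one dummy point per index: the dummy `k` is the lowest point in the
ranking `k` and lies above all points of `X` in the other rankings. -/
noncomputable def extendedRank (ρ : I → X → R) (i : I) : X ⊕ I → WithBot (R ⊕ₗ Fin (Fintype.card I))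
  | Sum.inl x => (toLex (Sum.inl (ρ i x)) : R ⊕ₗ Fin (Fintype.card I))
  | Sum.inr k => if k = i then ⊥ else
      (toLex (Sum.inr (Fintype.equivFin I k)) : R ⊕ₗ Fin (Fintype.card I))

lemma extendedRank_inr_self (i : I) : extendedRank ρ i (Sum.inr i) = ⊥ := by
  simp [extendedRank]

lemma extendedRank_injective (hρ : ∀ i, Function.Injective (ρ i)) (i : I) :
    Function.Injective (extendedRank ρ i) := by
  rintro (x | k) (x' | k') h
  · simp only [extendedRank, WithBot.coe_inj, toLex_inj, Sum.inl.injEq] at h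
    rw [hρ i h]
  · by_cases hk : k' = i <;> simp [extendedRank, hk] at h
  · by_cases hk : k = i <;> simp [extendedRank, hk] at h
  · by_cases hk : k = i <;> by_cases hk' : k' = i <;> simp_all [extendedRank]

variable [LinearOrder R]

lemma extendedRank_inl_le_inl {i : I} {x y : X} :
    extendedRank ρ i (Sum.inl x) ≤ extendedRank ρ i (Sum.inl y) ↔ ρ i x ≤ ρ i y := by
  simp [extendedRank]

lemma extendedRank_inr_lt_inl (i : I) (x : X) :
    extendedRank ρ i (Sum.inr i) < extendedRank ρ i (Sum.inl x) := by
  simp [extendedRank]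

lemma extendedRank_inl_lt_inr {i k : I} (hk : k ≠ i) (x : X) :
    extendedRank ρ i (Sum.inl x) < extendedRank ρ i (Sum.inr k) := by
  simp [extendedRank, hk]

lemma beats_dummy {τ : Finset (X ⊕ I)} {x : X} (hx : Sum.inl x ∈ τ) (d : I) :
    Beats (extendedRank ρ) τ d (Sum.inr d) :=
  fun _ hi => ⟨_, hx, extendedRank_inl_lt_inr hi.symm x⟩

/-- All dummies but `i₀`. -/
noncomputable def dummyFacet (X : Type*) (i₀ : I) : Finset (X ⊕ I) :=
  (Finset.univ.erase i₀).map Function.Embedding.inr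

lemma inl_notMem_dummyFacet {i₀ : I} (x : X) : Sum.inl x ∉ dummyFacet X i₀ := by
  simp [dummyFacet]

lemma inr_mem_dummyFacet {i i₀ : I} : Sum.inr i ∈ dummyFacet X i₀ ↔ i ≠ i₀ := by
  simp [dummyFacet]

lemma isCompletion_dummyFacet_iff [Nonempty X] {i₀ : I} {z : X ⊕ I} :
    IsCompletion (extendedRank ρ) (dummyFacet X i₀) z ↔
      ∃ x, z = Sum.inl x ∧ ∀ y, ρ i₀ y ≤ ρ i₀ x := by
  constructor
  · rintro ⟨hz, hdom⟩
    have hnotMem : ∀ y i, (∀ w ∈ insert z (dummyFacet X i₀),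
        extendedRank ρ i (Sum.inl y) ≤ extendedRank ρ i w) →
        Sum.inr i ∉ insert z (dummyFacet X i₀) := fun y i hi h =>
      (hi _ h).not_gt (extendedRank_inr_lt_inl i y)
    have hi₀ : ∀ i, Sum.inr i ∉ insert z (dummyFacet X i₀) → i = i₀ := fun i h => by
      by_contra hne
      exact h (Finset.mem_insert_of_mem (inr_mem_dummyFacet.2 hne))
    rcases z with x | k
    · refine ⟨x, rfl, fun y => ?_⟩
      obtain ⟨i, hi⟩ := hdom (Sum.inl y)
      obtain rfl := hi₀ i (hnotMem y i hi)
      exact extendedRank_inl_le_inl.1 (hi _ (Finset.mem_insert_self _ _))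
    · obtain ⟨y⟩ := ‹Nonempty X›
      obtain ⟨i, hi⟩ := hdom (Sum.inl y)
      have hk : k = i₀ := by
        by_contra hne
        exact hz (inr_mem_dummyFacet.2 hne)
      refine absurd (Finset.mem_insert.2 (Or.inl ?_)) (hnotMem y i hi)
      rw [hi₀ i (hnotMem y i hi), hk]
  · rintro ⟨x, rfl, hx⟩
    refine ⟨inl_notMem_dummyFacet x, ?_⟩
    rintro (y | k)
    · refine ⟨i₀, Finset.forall_mem_insert .. |>.2 ⟨extendedRank_inl_le_inl.2 (hx y), ?_⟩⟩
      rintro (z | j) hz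
      · exact absurd hz (inl_notMem_dummyFacet z)
      · exact (extendedRank_inl_lt_inr (inr_mem_dummyFacet.1 hz) y).le
    · exact ⟨k, fun z _ => (extendedRank_inr_self (ρ := ρ) k).trans_le bot_le⟩

lemma card_completions_dummyFacet [Fintype X] [Nonempty X] {i₀ : I}
    (hρ : Function.Injective (ρ i₀)) :
    (Finset.univ.filter (IsCompletion (extendedRank ρ) (dummyFacet X i₀))).card = 1 := by
  obtain ⟨t, ht⟩ := Finite.exists_max (ρ i₀)
  refine Finset.card_eq_one.2 ⟨Sum.inl t, Finset.ext fun z => ?_⟩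
  simp only [Finset.mem_filter, Finset.mem_univ, true_and, isCompletion_dummyFacet_iff,
    Finset.mem_singleton]
  refine ⟨?_, fun h => ⟨t, h, ht⟩⟩
  rintro ⟨x, rfl, hx⟩
  rw [hρ (le_antisymm (ht x) (hx t))]

lemma isDoor_dummyFacet [Nonempty X] [Finite X] (c : X → I) (i₀ : I) :
    IsDoor (extendedRank ρ) (Sum.elim c id) i₀ (dummyFacet X i₀) := by
  obtain ⟨t, ht⟩ := Finite.exists_max (ρ i₀)
  refine ⟨?_, (isCompletion_dummyFacet_iff.2 ⟨t, rfl, ht⟩).2.mono (Finset.subset_insert _ _), ?_⟩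
  · rw [dummyFacet, Finset.card_map, Finset.card_erase_add_one (Finset.mem_univ i₀),
      Finset.card_univ]
  · ext i
    simp [dummyFacet]

lemma IsDoor.exists_inl_mem {c : X → I} {i₀ : I} {τ : Finset (X ⊕ I)}
    (hτ : IsDoor (extendedRank ρ) (Sum.elim c id) i₀ τ) (hne : τ ≠ dummyFacet X i₀) :
    ∃ x, Sum.inl x ∈ τ := by
  by_contra! hinl
  refine hne (Finset.eq_of_subset_of_card_le ?_ ?_)
  · rintro (x | i) hz
    · exact absurd hz (hinl x)
    · have hi : i ∈ τ.image (Sum.elim c id) := Finset.mem_image.2 ⟨_, hz, rfl⟩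
      rw [hτ.2.2] at hi
      exact inr_mem_dummyFacet.2 (Finset.ne_of_mem_erase hi)
  · have hcard := hτ.1
    rw [dummyFacet, Finset.card_map, Finset.card_erase_of_mem (Finset.mem_univ i₀),
      Finset.card_univ]
    omega

end Dummies

section Existence

variable {I X R : Type*} [Finite I] [Nonempty I] [Finite X] [Nonempty X] [LinearOrder R]

theorem exists_dominant_colored_of_injective {ρ : I → X → R}
    (hρ : ∀ i, Function.Injective (ρ i)) (c : X → I) :
    ∃ (σ : Finset X) (C : Finset I), (∀ y, ∃ i ∈ C, ∀ x ∈ σ, ρ i y ≤ ρ i x) ∧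
      ∀ i ∈ C, ∃ x ∈ σ, c x = i := by
  have := Fintype.ofFinite I
  have := Fintype.ofFinite X
  obtain ⟨i₀⟩ := ‹Nonempty I›
  have htwo : ∀ τ, IsDoor (extendedRank ρ) (Sum.elim c id) i₀ τ → τ ≠ dummyFacet X i₀ →
      (Finset.univ.filter (IsCompletion (extendedRank ρ) τ)).card = 2 := fun τ hτ hne => by
    obtain ⟨x, hx⟩ := hτ.exists_inl_mem hne
    exact card_completions (extendedRank_injective hρ) ⟨_, hx⟩ hτ.2.1 hτ.1
      fun d => ⟨_, beats_dummy hx d⟩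
  obtain ⟨σ, ⟨-, hdom⟩, himg⟩ := exists_isRoom_image_eq_univ (isDoor_dummyFacet c i₀)
    (card_completions_dummyFacet (hρ i₀)) htwo
  refine ⟨Finset.univ.filter fun x => Sum.inl x ∈ σ,
    Finset.univ.filter fun i => Sum.inr i ∉ σ, fun y => ?_, fun i hi => ?_⟩
  · obtain ⟨i, hi⟩ := hdom (Sum.inl y)
    exact ⟨i, by simpa using fun h => (hi _ h).not_gt (extendedRank_inr_lt_inl i y),
      fun x hx => extendedRank_inl_le_inl.1 (hi _ (by simpa using hx))⟩
  · obtain ⟨x | k, hz, rfl⟩ := Finset.mem_image.1 (himg ▸ Finset.mem_univ i)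
    · exact ⟨x, by simpa using hz, rfl⟩
    · exact absurd hz (Finset.mem_filter.1 hi).2

/-- **Scarf's lemma**. -/
theorem exists_dominant_colored (ρ : I → X → R) (c : X → I) :
    ∃ (σ : Finset X) (C : Finset I), (∀ y, ∃ i ∈ C, ∀ x ∈ σ, ρ i y ≤ ρ i x) ∧
      ∀ i ∈ C, ∃ x ∈ σ, c x = i := by
  obtain ⟨n, ⟨e⟩⟩ := Finite.exists_equiv_fin X
  -- ties are broken by an enumeration of the points
  obtain ⟨σ, C, hdom, hcol⟩ := exists_dominant_colored_of_injective
    (ρ := fun i x => toLex (ρ i x, e x)) (fun i x y h => e.injective (by simp_all)) c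
  exact ⟨σ, C, fun y => (hdom y).imp fun i hi =>
    ⟨hi.1, fun x hx => Prod.Lex.monotone_fst _ _ (hi.2 x hx)⟩, hcol⟩

end Existence

end Scarf

section Covering

variable {I : Type*} [Fintype I]

/-- If a dominant set of grid points were bounded below by `b` with too small a sum, then there
would be room for a grid point above `b` in all coordinates. -/
lemma exists_grid_dominant [Nonempty I] (N : ℕ) (c : (I → ℕ) → I) :
    ∃ (σ : Finset (I → ℕ)) (b : I → ℕ), σ.Nonempty ∧ (∀ x ∈ σ, ∑ i, x i = N ∧ b ≤ x) ∧
      N < ∑ i, b i + Fintype.card I ∧ ∀ i, b i = 0 ∨ ∃ x ∈ σ, c x = i := by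
  classical
  let X := {x // x ∈ Finset.piAntidiag (Finset.univ : Finset I) N}
  have mem_grid : ∀ {x}, x ∈ Finset.piAntidiag (Finset.univ : Finset I) N ↔ ∑ i, x i = N := by
    simp
  have : Nonempty X := ⟨⟨Pi.single (Classical.arbitrary I) N, by simp⟩⟩
  obtain ⟨σ, C, hdom, hcol⟩ :=
    Scarf.exists_dominant_colored (fun i (x : X) => x.1 i) fun x => c x.1
  obtain ⟨i₁, hi₁, -⟩ := hdom (Classical.arbitrary X)
  have hσ : σ.Nonempty := (hcol i₁ hi₁).imp fun x hx => hx.1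
  choose l hlσ hl using fun i => Finset.exists_min_image σ (fun x => x.1 i) hσ
  let b : I → ℕ := fun i => if i ∈ C then (l i).1 i else 0
  have hsum : N < ∑ i ∈ C, (b i + 1) := by
    by_contra! hle
    let y : I → ℕ := fun i =>
      (if i ∈ C then b i + 1 else 0) + if i = i₁ then N - ∑ i ∈ C, (b i + 1) else 0
    have hy : ∑ i, y i = N := by
      simp only [y, Finset.sum_add_distrib, Finset.sum_ite_eq', Finset.mem_univ, if_true,
        Finset.sum_ite_mem, Finset.univ_inter] at hle ⊢
      omega
    obtain ⟨i, hi, hdom⟩ := hdom ⟨y, mem_grid.2 hy⟩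
    have := hdom (l i) (hlσ i)
    simp only [y, b, if_pos hi] at this
    omega
  refine ⟨σ.map (Function.Embedding.subtype _), b, hσ.map, fun x hx => ?_, ?_, fun i => ?_⟩
  · obtain ⟨x, hxσ, rfl⟩ := Finset.mem_map.1 hx
    refine ⟨mem_grid.1 x.2, fun i => ?_⟩
    by_cases hi : i ∈ C
    · simpa [b, hi] using hl i x hxσ
    · simp [b, hi]
  · calc N < ∑ i ∈ C, (b i + 1) := hsum
      _ ≤ ∑ i, (b i + 1) := Finset.sum_le_univ_sum_of_nonneg fun _ => Nat.zero_le _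
      _ = ∑ i, b i + Fintype.card I := by simp [Finset.sum_add_distrib]
  · by_cases hi : i ∈ C
    · obtain ⟨x, hx, hc⟩ := hcol i hi
      exact Or.inr ⟨x, Finset.mem_map_of_mem _ hx, hc⟩
    · simp [b, hi]

lemma exists_grid_cluster [Nonempty I] (N : ℕ) (c : (I → ℕ) → I) :
    ∃ σ : Finset (I → ℕ), σ.Nonempty ∧ (∀ x ∈ σ, ∑ i, x i = N) ∧
      (∀ x ∈ σ, ∀ x' ∈ σ, ∀ k, x k ≤ x' k + Fintype.card I) ∧
      ∀ i, (∀ x ∈ σ, x i ≤ Fintype.card I) ∨ ∃ x ∈ σ, c x = i := by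
  obtain ⟨σ, b, hσ, hgrid, hN, hcol⟩ := exists_grid_dominant N c
  have hle : ∀ x ∈ σ, ∀ k, x k ≤ b k + Fintype.card I := fun x hx k => by
    have hk : x k - b k ≤ ∑ i, (x i - b i) :=
      Finset.single_le_sum (f := fun i => x i - b i) (fun _ _ => Nat.zero_le _)
        (Finset.mem_univ k)
    have hsum : ∑ i, (x i - b i) + ∑ i, b i = N := by
      rw [← Finset.sum_add_distrib, ← (hgrid x hx).1]
      exact Finset.sum_congr rfl fun i _ => Nat.sub_add_cancel ((hgrid x hx).2 i)
    omega
  refine ⟨σ, hσ, fun x hx => (hgrid x hx).1, fun x hx x' hx' k => ?_, fun i => ?_⟩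
  · have : b k ≤ x' k := (hgrid x' hx').2 k
    have := hle x hx k
    omega
  · refine (hcol i).imp_left fun h x hx => ?_
    simpa [h] using hle x hx i

lemma exists_mem_stdSimplex_approx {A : I → Set (I → ℝ)} (hA : stdSimplex ℝ I ⊆ ⋃ i, A i)
    (hne : (stdSimplex ℝ I).Nonempty) {ε : ℝ} (hε : 0 < ε) :
    ∃ x ∈ stdSimplex ℝ I, ∀ i, x i < ε ∨ ∃ x' ∈ A i, dist x' x < ε := by
  obtain ⟨x₀, hx₀⟩ := hne
  have : Nonempty I := ⟨(Set.mem_iUnion.1 (hA hx₀)).choose⟩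
  obtain ⟨N, hN⟩ := exists_nat_gt (Fintype.card I / ε)
  have hN0 : (0 : ℝ) < N := (by positivity : 0 ≤ Fintype.card I / ε).trans_lt hN
  have hsmall : (Fintype.card I : ℝ) / N < ε := by rwa [div_lt_comm₀ hN0 hε]
  let g : (I → ℕ) → I → ℝ := fun x i => x i / N
  have hg : ∀ x : I → ℕ, ∑ i, x i = N → g x ∈ stdSimplex ℝ I := fun x hx =>
    ⟨fun i => by positivity, by
      rw [← Finset.sum_div, ← Nat.cast_sum, hx, div_self hN0.ne']⟩
  have hcover : ∀ x : I → ℕ, ∑ i, x i = N → ∃ i, g x ∈ A i := fun x hx =>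
    Set.mem_iUnion.1 (hA (hg x hx))
  choose! c hc using hcover
  obtain ⟨σ, ⟨x, hx⟩, hgrid, hclose, hcol⟩ := exists_grid_cluster N c
  refine ⟨g x, hg x (hgrid x hx), fun i => ?_⟩
  rcases hcol i with hi | ⟨x', hx', rfl⟩
  · refine Or.inl (hsmall.trans_le' ?_)
    exact div_le_div_of_nonneg_right (mod_cast hi x hx) hN0.le
  · refine Or.inr ⟨g x', hc x' (hgrid x' hx'), (dist_pi_lt_iff hε).2 fun k => ?_⟩
    refine hsmall.trans_le' ?_
    rw [Real.dist_eq, ← sub_div, abs_div, abs_of_pos hN0]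
    refine div_le_div_of_nonneg_right (abs_sub_le_iff.2 ⟨?_, ?_⟩) hN0.le
    · exact sub_le_iff_le_add'.2 (mod_cast hclose x' hx' x hx k)
    · exact sub_le_iff_le_add'.2 (mod_cast hclose x hx x' hx' k)

/-- The covering form of the theorem of Knaster, Kuratowski and Mazurkiewicz. -/
theorem exists_mem_stdSimplex_forall_eq_zero_or_mem {A : I → Set (I → ℝ)}
    (hclosed : ∀ i, IsClosed (A i)) (hA : stdSimplex ℝ I ⊆ ⋃ i, A i)
    (hne : (stdSimplex ℝ I).Nonempty) : ∃ x ∈ stdSimplex ℝ I, ∀ i, x i = 0 ∨ x ∈ A i := by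
  choose x hxΔ hx using fun n : ℕ =>
    exists_mem_stdSimplex_approx hA hne (Nat.one_div_pos_of_nat (α := ℝ) (n := n))
  obtain ⟨z, hz, φ, hφ, hlim⟩ := (isCompact_stdSimplex ℝ I).tendsto_subseq hxΔ
  refine ⟨z, hz, fun i => or_iff_not_imp_left.2 fun hzi => ?_⟩
  rw [← (hclosed i).closure_eq, Metric.mem_closure_iff]
  intro ε hε
  have hε' : 0 < min (ε / 2) (z i / 2) := by
    have := (hz.1 i).lt_of_ne' hzi
    positivity
  have hnear : ∀ᶠ n in Filter.atTop, dist (x (φ n)) z < min (ε / 2) (z i / 2) :=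
    Metric.tendsto_nhds.1 hlim _ hε'
  have hfine : ∀ᶠ n in Filter.atTop, (1 : ℝ) / ((φ n : ℕ) + 1) < min (ε / 2) (z i / 2) :=
    (tendsto_one_div_add_atTop_nhds_zero_nat.comp hφ.tendsto_atTop).eventually_lt_const hε'
  obtain ⟨n, hnear, hfine⟩ := (hnear.and hfine).exists
  obtain ⟨hnear, hnear'⟩ := lt_min_iff.1 hnear
  obtain ⟨hfine, hfine'⟩ := lt_min_iff.1 hfine
  rcases hx (φ n) i with hlt | ⟨x', hx', hdist⟩
  · have := (abs_lt.1 ((dist_le_pi_dist (x (φ n)) z i).trans_lt hnear')).1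
    linarith
  · refine ⟨x', hx', ?_⟩
    have := dist_triangle_left z x' (x (φ n))
    rw [dist_comm] at hdist
    linarith

end Covering

section Kakutani

variable {E : Type*} [NormedAddCommGroup E] [NormedSpace ℝ E] {K : Set E} {F : E → Set E}

lemma sum_smul_mem_convexHull {ι : Type*} [Fintype ι] {w : ι → ℝ} (hw : w ∈ stdSimplex ℝ ι)
    {y : ι → E} {s : Set E} (hy : ∀ a, w a ≠ 0 → y a ∈ s) :
    ∑ a, w a • y a ∈ convexHull ℝ s := by
  have hsupp : ∑ a with w a ≠ 0, w a • y a = ∑ a, w a • y a :=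
    Finset.sum_filter_of_ne fun a _ h h0 => h (by rw [h0, zero_smul])
  rw [← hsupp]
  refine (convex_convexHull ℝ s).sum_mem (fun a _ => hw.1 a) ?_ fun a ha =>
    subset_convexHull ℝ s (hy a (Finset.mem_filter.1 ha).2)
  rw [Finset.sum_filter_ne_zero, hw.2]

/-- The covering theorem is applied to the weights on an `ε`-net `t` for which the weighted mean of
chosen values is `ε`-close to a given point of `t`. -/
lemma exists_mem_convexHull_nearby (hK : IsCompact K) (hKc : Convex ℝ K) (hKne : K.Nonempty)
    (hsub : ∀ x ∈ K, F x ⊆ K) (hne : ∀ x ∈ K, (F x).Nonempty) {ε : ℝ} (hε : 0 < ε) :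
    ∃ x ∈ K, x ∈ convexHull ℝ {y | ∃ a ∈ K, dist x a ≤ ε ∧ y ∈ F a} := by
  classical
  obtain ⟨t, htK, htfin, hcover⟩ := hK.finite_cover_balls hε
  have := htfin.fintype
  choose y hy using fun a : t => hne a (htK a.2)
  let g : (t → ℝ) → E := fun w => ∑ a, w a • y a
  have hgK : ∀ w ∈ stdSimplex ℝ t, g w ∈ K := fun w hw =>
    hKc.sum_mem (fun a _ => hw.1 a) hw.2 fun a _ => hsub _ (htK a.2) (hy a)
  have hclosed : ∀ a : t, IsClosed {w | dist (g w) a ≤ ε} := fun a =>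
    isClosed_le (by fun_prop) continuous_const
  have hnet : stdSimplex ℝ t ⊆ ⋃ a : t, {w | dist (g w) a ≤ ε} := fun w hw => by
    obtain ⟨a, ha, hdist⟩ := Set.mem_iUnion₂.1 (hcover (hgK w hw))
    exact Set.mem_iUnion.2 ⟨⟨a, ha⟩, (Metric.mem_ball.1 hdist).le⟩
  have hΔ : (stdSimplex ℝ t).Nonempty := by
    obtain ⟨x, hx⟩ := hKne
    obtain ⟨a, ha, -⟩ := Set.mem_iUnion₂.1 (hcover hx)
    exact ⟨_, single_mem_stdSimplex ℝ (⟨a, ha⟩ : t)⟩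
  obtain ⟨w, hw, hsupp⟩ := exists_mem_stdSimplex_forall_eq_zero_or_mem hclosed hnet hΔ
  exact ⟨g w, hgK w hw, sum_smul_mem_convexHull hw fun a ha =>
    ⟨a, htK a.2, (hsupp a).resolve_left ha, hy a⟩⟩

lemma upperHemicontinuous_of_isClosed_graph {X Y : Type*} [TopologicalSpace X]
    [FirstCountableTopology X] [PseudoMetricSpace Y] {G : Set (X × Y)} (hG : IsClosed G)
    {s : Set Y} (hs : IsCompact s) (hGs : ∀ q ∈ G, q.2 ∈ s) :
    UpperHemicontinuous fun x => {y | (x, y) ∈ G} :=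
  upperHemicontinuous_iff.2 fun _ =>
    .of_sequences hs.isSeqCompact (.of_forall fun _ _ hy => hGs _ hy) fun _ hx _ hy _ hy₀ =>
      hG.mem_of_tendsto (hx.prodMk_nhds hy₀) (.of_forall hy)

/-- **Kakutani's fixed point theorem** in normed spaces. -/
theorem exists_mem_self_of_isClosed_graph (hK : IsCompact K) (hKc : Convex ℝ K)
    (hKne : K.Nonempty) (hsub : ∀ x ∈ K, F x ⊆ K) (hne : ∀ x ∈ K, (F x).Nonempty)
    (hconv : ∀ x ∈ K, Convex ℝ (F x))
    (hclosed : IsClosed {q : E × E | q.1 ∈ K ∧ q.2 ∈ F q.1}) : ∃ x ∈ K, x ∈ F x := by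
  choose x hxK hx using fun n : ℕ =>
    exists_mem_convexHull_nearby hK hKc hKne hsub hne (Nat.one_div_pos_of_nat (α := ℝ) (n := n))
  obtain ⟨z, hz, φ, hφ, hlim⟩ := hK.tendsto_subseq hxK
  refine ⟨z, hz, ?_⟩
  have hFz : IsClosed (F z) := by
    simpa [hz] using hclosed.preimage (Continuous.prodMk_right z)
  rw [← hFz.closure_eq, Metric.mem_closure_iff]
  intro δ hδ
  have husc : ∀ᶠ a in nhds z, a ∈ K → F a ⊆ Metric.thickening (δ / 2) (F z) := by
    have hG := upperHemicontinuous_of_isClosed_graph hclosed hK fun q hq => hsub _ hq.1 hq.2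
    have hmem : Metric.thickening (δ / 2) (F z) ∈ nhdsSet {v | z ∈ K ∧ v ∈ F z} := by
      simpa [hz] using Metric.isOpen_thickening.mem_nhdsSet.2
        (Metric.self_subset_thickening (half_pos hδ) (F z))
    filter_upwards [upperHemicontinuous_iff.1 hG z _ hmem] with a ha haK v hv
    exact subset_of_mem_nhdsSet ha ⟨haK, hv⟩
  obtain ⟨η, hη, hball⟩ := Metric.eventually_nhds_iff.1 husc
  have hnear : ∀ᶠ n in Filter.atTop, dist (x (φ n)) z < min (η / 2) (δ / 2) :=
    Metric.tendsto_nhds.1 hlim _ (by positivity)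
  have hfine : ∀ᶠ n in Filter.atTop, (1 : ℝ) / ((φ n : ℕ) + 1) < η / 2 :=
    (tendsto_one_div_add_atTop_nhds_zero_nat.comp hφ.tendsto_atTop).eventually_lt_const
      (half_pos hη)
  obtain ⟨n, hnear, hfine⟩ := (hnear.and hfine).exists
  obtain ⟨hnear, hnear'⟩ := lt_min_iff.1 hnear
  have hmem : x (φ n) ∈ Metric.thickening (δ / 2) (F z) := by
    refine convexHull_min ?_ ((hconv z hz).thickening _) (hx (φ n))
    rintro v ⟨a, ha, hda, hv⟩
    refine hball ?_ ha hv
    have := dist_triangle_left a z (x (φ n))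
    linarith
  obtain ⟨v, hv, hdist⟩ := Metric.mem_thickening_iff.1 hmem
  refine ⟨v, hv, ?_⟩
  have := dist_triangle_left z v (x (φ n))
  linarith

end Kakutani

section Greedy

variable {R : Type*} [AddCommGroup R] [LinearOrder R] [IsOrderedAddMonoid R]

lemma min_max_zero_sub_add_min {v : R} (hv : 0 ≤ v) (q b : R) :
    min v (max 0 (q - b)) + min q b = min q (v + b) := by
  rcases le_total q b with h | h
  · rw [max_eq_left (sub_nonpos.2 h), min_eq_right hv, min_eq_left h, zero_add,
      min_eq_left (h.trans (le_add_of_nonneg_left hv))]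
  · rw [max_eq_right (sub_nonneg.2 h), min_eq_right h, ← min_add_add_right, sub_add_cancel,
      min_comm]

lemma sum_min_max_zero_sub_sum {α : Type*} [Fintype α] (r : α → α → Prop)
    [IsStrictTotalOrder α r] [DecidableRel r] {v : α → R} (hv : 0 ≤ v) {q : R} (hq : 0 ≤ q) :
    ∑ k, min (v k) (max 0 (q - ∑ k' with r k' k, v k')) = min q (∑ k, v k) := by
  let _ := linearOrderOfSTO r
  suffices greedy_sum : ∀ s : Finset α,
      ∑ k ∈ s, min (v k) (max 0 (q - ∑ k' ∈ s with r k' k, v k')) = min q (∑ k ∈ s, v k) from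
    greedy_sum Finset.univ
  intro s
  induction s using Finset.induction_on_max with
  | empty => simp [hq]
  | insert a s hs ih =>
    have ha : a ∉ s := fun h => lt_irrefl a (hs a h)
    have above_last : {k' ∈ insert a s | r k' a} = s := by
      rw [Finset.filter_insert, if_neg (irrefl_of r a)]
      exact Finset.filter_true_of_mem hs
    have above_earlier : ∀ k ∈ s, {k' ∈ insert a s | r k' k} = {k' ∈ s | r k' k} := by
      intro k hk
      rw [Finset.filter_insert, if_neg (asymm_of r (hs k hk))]
    calc ∑ k ∈ insert a s, min (v k) (max 0 (q - ∑ k' ∈ insert a s with r k' k, v k'))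
      _ = min (v a) (max 0 (q - ∑ k ∈ s, v k)) +
          ∑ k ∈ s, min (v k) (max 0 (q - ∑ k' ∈ s with r k' k, v k')) := by
        rw [Finset.sum_insert ha, above_last]
        exact congrArg _ (Finset.sum_congr rfl fun k hk => by rw [above_earlier k hk])
      _ = min q (∑ k ∈ insert a s, v k) := by
        rw [ih, min_max_zero_sub_add_min (hv a), Finset.sum_insert ha]

end Greedy

section Maximizers

lemma convex_setOf_isMaxOn {𝕜 E β : Type*} [Semiring 𝕜] [PartialOrder 𝕜] [AddCommMonoid E]
    [SMul 𝕜 E] [Preorder β] {s : Set E} {f : E → β} (hf : QuasiconcaveOn 𝕜 s f) :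
    Convex 𝕜 {x | x ∈ s ∧ IsMaxOn f s x} := by
  intro x hx y hy a b ha hb hab
  have superlevel := fun z (hz : z ∈ s) =>
    hf (f z) ⟨hx.1, hx.2 hz⟩ ⟨hy.1, hy.2 hz⟩ ha hb hab
  exact ⟨(superlevel x hx.1).1, fun z hz => (superlevel z hz).2⟩

lemma isClosed_setOf_isMaxOn {X Y β : Type*} [TopologicalSpace X] [TopologicalSpace Y]
    [TopologicalSpace β] [Preorder β] [OrderClosedTopology β] {f : X → Y → β} {s : Set X}
    {t : Set Y} (hs : IsClosed s) (ht : IsClosed t)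
    (hf : ContinuousOn (fun r : X × Y => f r.1 r.2) (s ×ˢ t)) :
    IsClosed {r : X × Y | r.1 ∈ s ∧ r.2 ∈ t ∧ IsMaxOn (f r.1) t r.2} := by
  have dominates : ∀ y ∈ t, IsClosed {r ∈ s ×ˢ t | f r.1 y ≤ f r.1 r.2} := fun y hy =>
    (hs.prod ht).isClosed_le
      (hf.comp (f := fun r : X × Y => (r.1, y)) (by fun_prop) fun r hr => ⟨hr.1, hy⟩) hf
  convert (hs.prod ht).inter (isClosed_biInter dominates) using 1
  ext r
  simp only [isMaxOn_iff, Set.mem_inter_iff, Set.mem_prod, Set.mem_iInter, Set.mem_ofPred_eq]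
  grind

variable {𝕜 ι : Type*} [CommRing 𝕜] [LinearOrder 𝕜] [IsStrictOrderedRing 𝕜] [Fintype ι]
  {a p : ι → 𝕜}

lemma le_dotProduct_of_isMaxOn_stdSimplex (h : IsMaxOn (· ⬝ᵥ a) (stdSimplex 𝕜 ι) p) (c : ι) :
    a c ≤ p ⬝ᵥ a := by
  classical
  simpa using h (single_mem_stdSimplex 𝕜 c)

lemma eq_dotProduct_of_isMaxOn_stdSimplex (hp : p ∈ stdSimplex 𝕜 ι)
    (h : IsMaxOn (· ⬝ᵥ a) (stdSimplex 𝕜 ι) p) {c : ι} (hc : 0 < p c) : a c = p ⬝ᵥ a := by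
  have slack_sum : ∑ c', p c' * (p ⬝ᵥ a - a c') = 0 := by
    simp only [mul_sub, Finset.sum_sub_distrib, ← Finset.sum_mul, hp.2, one_mul]
    exact sub_self _
  have slack : p c * (p ⬝ᵥ a - a c) = 0 :=
    (Finset.sum_eq_zero_iff_of_nonneg fun c' _ =>
      mul_nonneg (hp.1 c') (sub_nonneg.2 (le_dotProduct_of_isMaxOn_stdSimplex h c'))).1
      slack_sum c (Finset.mem_univ c)
  exact (sub_eq_zero.1 ((mul_eq_zero.1 slack).resolve_left hc.ne')).symm

lemma exists_pos_of_mem_stdSimplex (hp : p ∈ stdSimplex 𝕜 ι) : ∃ c, 0 < p c := by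
  obtain ⟨c, -, hc⟩ := Finset.exists_lt_of_sum_lt (s := Finset.univ) (f := fun _ => 0) (g := p)
    (by simp [hp.2])
  exact ⟨c, hc⟩

end Maximizers

section Utility

variable {ι : Type*} {u : (ι → ℝ) → ℝ} {z z' : ι → ℝ}

lemma exists_lt_apply_smul (hu : ContinuousOn u (Set.Ici 0)) (hz : 0 ≤ z) {a : ℝ} (ha : a < u z) :
    ∃ t ∈ Set.Ioo (0 : ℝ) 1, a < u (t • z) := by
  have cont_ray : ContinuousOn (fun t : ℝ => u (t • z)) (Set.Ici 0) :=
    hu.comp (by fun_prop) fun t ht => smul_nonneg ht hz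
  have near_one : ∀ᶠ t in nhdsWithin (1 : ℝ) (Set.Iio 1), a < u (t • z) :=
    ((cont_ray.continuousAt (Ici_mem_nhds one_pos)).eventually
      (lt_mem_nhds (by simpa using ha))).filter_mono nhdsWithin_le_nhds
  obtain ⟨t, ht, ht01⟩ := (near_one.and (Ioo_mem_nhdsLT one_pos)).exists
  exact ⟨t, ht01, ht⟩

lemma lt_apply_add_single [DecidableEq ι] (hmono : StrictMonoOn u (Set.Ici 0)) (hz : 0 ≤ z)
    (c : ι) {t : ℝ} (ht : 0 < t) : u z < u (z + Pi.single c t) := by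
  have hs : (0 : ι → ℝ) < Pi.single c t := Pi.single_pos.2 ht
  exact hmono hz (add_nonneg hz hs.le) (lt_add_of_pos_right z hs)

/-- Shrink `z'` to `s • z'`, still better than `z`: by quasi-concavity mixing `z` with `s • z'` does
no harm, and mixing it with `z'` instead gives more of the goods. -/
lemma lt_apply_mix (hcont : ContinuousOn u (Set.Ici 0)) (hconc : QuasiconcaveOn ℝ (Set.Ici 0) u)
    (hmono : StrictMonoOn u (Set.Ici 0)) (hz : 0 ≤ z) (hz' : 0 ≤ z') (hlt : u z < u z') {t : ℝ}
    (ht : t ∈ Set.Ioo (0 : ℝ) 1) : u z < u ((1 - t) • z + t • z') := by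
  obtain ⟨s, ⟨hs0, hs1⟩, hs⟩ := exists_lt_apply_smul hcont hz' hlt
  have hz'_pos : 0 < z' := by
    refine hz'.lt_of_ne fun h => hlt.not_ge ?_
    exact hmono.monotoneOn (h ▸ Set.self_mem_Ici) hz (h ▸ hz)
  have shrunk_lt : s • z' < z' := by
    simpa using smul_lt_smul_of_pos_right hs1 hz'_pos
  have hsz' : 0 ≤ s • z' := smul_nonneg hs0.le hz'
  have ht1 : 0 ≤ 1 - t := sub_nonneg.2 ht.2.le
  calc u z ≤ u ((1 - t) • z + t • s • z') :=
        (hconc (u z) ⟨hz, le_rfl⟩ ⟨hsz', hs.le⟩ ht1 ht.1.le (sub_add_cancel 1 t)).2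
    _ < u ((1 - t) • z + t • z') := by
        refine hmono ?_ ?_ (add_lt_add_right (smul_lt_smul_of_pos_left shrunk_lt ht.1) _)
        · exact add_nonneg (smul_nonneg ht1 hz) (smul_nonneg ht.1.le hsz')
        · exact add_nonneg (smul_nonneg ht1 hz) (smul_nonneg ht.1.le hz')

end Utility

section QuasiDemand

variable {ι : Type*} [Fintype ι] {u : (ι → ℝ) → ℝ} {b p z : ι → ℝ} {w : ℝ}

/-- `z` is a quasi-demand for the utility `u` among the bundles up to `b`: it is affordable at
prices `p` with wealth `w`, and no bundle that costs strictly less than `w` is better. Unlike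
demand, this notion has a closed graph even where the wealth vanishes. -/
def IsQuasiDemand (u : (ι → ℝ) → ℝ) (b p : ι → ℝ) (w : ℝ) (z : ι → ℝ) : Prop :=
  z ∈ Set.Icc 0 b ∧ p ⬝ᵥ z ≤ w ∧ ∀ z' ∈ Set.Icc 0 b, p ⬝ᵥ z' < w → u z' ≤ u z

lemma exists_isQuasiDemand (hu : ContinuousOn u (Set.Ici 0)) (hb : 0 ≤ b) (p : ι → ℝ)
    (hw : 0 ≤ w) : ∃ z, IsQuasiDemand u b p w z := by
  have budget_closed : IsClosed {z | p ⬝ᵥ z ≤ w} := isClosed_le (by fun_prop) continuous_const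
  obtain ⟨z, ⟨hz, hzw⟩, hmax⟩ := (isCompact_Icc.inter_right budget_closed).exists_isMaxOn
    ⟨0, ⟨le_rfl, hb⟩, by simpa using hw⟩ (hu.mono fun z hz => hz.1.1)
  exact ⟨z, hz, hzw, fun z' hz' hlt => hmax ⟨hz', hlt.le⟩⟩

lemma convex_setOf_isQuasiDemand (hu : QuasiconcaveOn ℝ (Set.Ici 0) u) (b p : ι → ℝ) (w : ℝ) :
    Convex ℝ {z | IsQuasiDemand u b p w z} := by
  rintro x ⟨hx, hxw, hxu⟩ y ⟨hy, hyw, hyu⟩ s t hs ht hst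
  refine ⟨convex_Icc 0 b hx hy hs ht hst, ?_, fun z hz hlt => ?_⟩
  · exact convex_halfSpace_le ⟨dotProduct_add p, fun c z => dotProduct_smul c p z⟩ w
      hxw hyw hs ht hst
  · exact (hu (u z) ⟨hx.1, hxu z hz hlt⟩ ⟨hy.1, hyu z hz hlt⟩ hs ht hst).2

lemma isClosed_setOf_isQuasiDemand (hu : ContinuousOn u (Set.Ici 0)) (b : ι → ℝ) :
    IsClosed {r : (ι → ℝ) × ℝ × (ι → ℝ) | IsQuasiDemand u b r.1 r.2.1 r.2.2} := by
  have upper_closed : ∀ z', IsClosed {z ∈ Set.Icc 0 b | u z' ≤ u z} := fun z' =>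
    isClosed_Icc.isClosed_le continuousOn_const (hu.mono fun z hz => hz.1)
  have bundle_closed : IsClosed {r : (ι → ℝ) × ℝ × (ι → ℝ) | r.2.2 ∈ Set.Icc 0 b} :=
    isClosed_Icc.preimage (by fun_prop)
  have budget_closed : IsClosed {r : (ι → ℝ) × ℝ × (ι → ℝ) | r.1 ⬝ᵥ r.2.2 ≤ r.2.1} :=
    isClosed_le (by fun_prop) (by fun_prop)
  have optimal_closed : ∀ z' ∈ Set.Icc 0 b, IsClosed
      ({r : (ι → ℝ) × ℝ × (ι → ℝ) | r.2.1 ≤ r.1 ⬝ᵥ z'} ∪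
        {r | r.2.2 ∈ {z ∈ Set.Icc 0 b | u z' ≤ u z}}) := fun z' _ =>
    (isClosed_le (by fun_prop) (by fun_prop)).union ((upper_closed z').preimage (by fun_prop))
  convert bundle_closed.inter (budget_closed.inter (isClosed_biInter optimal_closed)) using 1
  ext r
  simp only [IsQuasiDemand, Set.mem_inter_iff, Set.mem_iInter, Set.mem_union, Set.mem_ofPred_eq]
  grind

namespace IsQuasiDemand

lemma le_of_cost_le (h : IsQuasiDemand u b p w z) (hu : ContinuousOn u (Set.Ici 0)) (hw : 0 < w)
    {z' : ι → ℝ} (hz' : z' ∈ Set.Icc 0 b) (hcost : p ⬝ᵥ z' ≤ w) : u z' ≤ u z := by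
  by_contra! hlt
  obtain ⟨t, ⟨ht0, ht1⟩, ht⟩ := exists_lt_apply_smul hu hz'.1 hlt
  refine ht.not_ge (h.2.2 (t • z') ⟨smul_nonneg ht0.le hz'.1, ?_⟩ ?_)
  · exact (smul_le_of_le_one_left hz'.1 ht1.le).trans hz'.2
  · rw [dotProduct_smul, smul_eq_mul]
    nlinarith

lemma price_pos (h : IsQuasiDemand u b p w z) (hu : ContinuousOn u (Set.Ici 0))
    (hmono : StrictMonoOn u (Set.Ici 0)) (hw : 0 < w) {c : ι} (hc : z c < b c) : 0 < p c := by
  classical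
  by_contra! hp
  have ht : 0 < b c - z c := sub_pos.2 hc
  refine (lt_apply_add_single hmono h.1.1 c ht).not_ge (h.le_of_cost_le hu hw ⟨?_, ?_⟩ ?_)
  · exact add_nonneg h.1.1 (Pi.single_nonneg.2 ht.le)
  · intro c'
    rcases eq_or_ne c' c with rfl | hne
    · simp
    · simpa [hne] using h.1.2 c'
  · rw [dotProduct_add, dotProduct_single]
    exact (add_le_of_nonpos_right (mul_nonpos_of_nonpos_of_nonneg hp ht.le)).trans h.2.1

end IsQuasiDemand

end QuasiDemand

lemma concaveOn_finsetSum {𝕜 E β κ : Type*} [Semiring 𝕜] [PartialOrder 𝕜] [AddCommMonoid E]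
    [AddCommMonoid β] [PartialOrder β] [IsOrderedAddMonoid β] [SMul 𝕜 E] [DistribMulAction 𝕜 β]
    {s : Set E} (hs : Convex 𝕜 s) {t : Finset κ} {f : κ → E → β}
    (hf : ∀ k ∈ t, ConcaveOn 𝕜 s (f k)) : ConcaveOn 𝕜 s fun x => ∑ k ∈ t, f k x := by
  refine ⟨hs, fun x hx y hy a b ha hb hab => ?_⟩
  simp only [Finset.smul_sum, ← Finset.sum_add_distrib]
  exact Finset.sum_le_sum fun k hk => (hf k hk).2 hx hy ha hb hab

namespace DigitalMarket

open scoped Classical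

section Bundles

variable {J : Type*} [Fintype J] {u : (Option J → ℝ) → ℝ} {p z : Option J → ℝ} {w B : ℝ}

namespace IsOptimalBundle

lemma price_pos (h : IsOptimalBundle u p w z) (hmono : StrictMonoOn u (Set.Ici 0))
    (c : Option J) : 0 < p c := by
  by_contra! hc
  refine (lt_apply_add_single hmono h.1 c one_pos).not_ge (h.2.2 _ ?_ ?_)
  · exact add_nonneg h.1 (Pi.single_nonneg.2 zero_le_one)
  · change p ⬝ᵥ (z + Pi.single c 1) ≤ w
    rw [dotProduct_add, dotProduct_single, mul_one]
    exact (add_le_of_nonpos_right hc).trans h.2.1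

lemma budget_eq (h : IsOptimalBundle u p w z) (hmono : StrictMonoOn u (Set.Ici 0)) :
    ∑ c, p c * z c = w := by
  refine h.2.1.eq_of_not_lt fun hlt => ?_
  have hp := h.price_pos hmono none
  have ht : 0 < (w - ∑ c, p c * z c) / p none := div_pos (sub_pos.2 hlt) hp
  refine (lt_apply_add_single hmono h.1 none ht).not_ge (h.2.2 _ ?_ ?_)
  · exact add_nonneg h.1 (Pi.single_nonneg.2 ht.le)
  · change p ⬝ᵥ (z + Pi.single none _) ≤ w
    rw [dotProduct_add, dotProduct_single, mul_div_cancel₀ _ hp.ne']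
    exact (add_sub_cancel (p ⬝ᵥ z) w).le

lemma flat (h : IsOptimalBundle u p w z) (hp : 0 ≤ p) (hB : 0 ≤ B) (hz : ∀ c, z c ≤ B) :
    IsOptimalBundle (fun z => u fun c => min (z c) B) p w z := by
  refine ⟨h.1, h.2.1, fun z' hz' hw => ?_⟩
  simp only [fun c => min_eq_left (hz c)]
  refine h.2.2 _ (fun c => le_min (hz' c) hB) (le_trans ?_ hw)
  exact dotProduct_le_dotProduct_of_nonneg_left (fun c => min_le_left (z' c) B) hp

/-- A better affordable bundle could be mixed into `z` so slightly that the mixture stays below `B`,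
where the flattening is not felt. -/
lemma of_flat (h : IsOptimalBundle (fun z => u fun c => min (z c) B) p w z) (hz : ∀ c, z c < B)
    (hcont : ContinuousOn u (Set.Ici 0)) (hconc : QuasiconcaveOn ℝ (Set.Ici 0) u)
    (hmono : StrictMonoOn u (Set.Ici 0)) : IsOptimalBundle u p w z := by
  refine ⟨h.1, h.2.1, fun z' hz' hw => ?_⟩
  by_contra! hlt
  have below_cap : ∀ᶠ t in nhds (0 : ℝ), ∀ c, ((1 - t) • z + t • z') c < B := by
    simp only [Pi.add_apply, Pi.smul_apply, smul_eq_mul]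
    refine Filter.eventually_all.2 fun c => ?_
    have : ContinuousAt (fun t : ℝ => (1 - t) * z c + t * z' c) 0 := by fun_prop
    exact this.eventually (gt_mem_nhds (by simpa using hz c))
  obtain ⟨t, hcap, ht⟩ :=
    ((below_cap.filter_mono nhdsWithin_le_nhds).and (Ioo_mem_nhdsGT one_pos)).exists
  have mix_nonneg : 0 ≤ (1 - t) • z + t • z' :=
    add_nonneg (smul_nonneg (sub_nonneg.2 ht.2.le) h.1) (smul_nonneg ht.1.le hz')
  have mix_affordable : p ⬝ᵥ ((1 - t) • z + t • z') ≤ w :=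
    convex_halfSpace_le ⟨dotProduct_add p, fun c z => dotProduct_smul c p z⟩ w h.2.1 hw
      (sub_nonneg.2 ht.2.le) ht.1.le (sub_add_cancel 1 t)
  have mix_le := h.2.2 _ mix_nonneg mix_affordable
  simp only [fun c => min_eq_left (hcap c).le, fun c => min_eq_left (hz c).le] at mix_le
  exact (lt_apply_mix hcont hconc hmono h.1 hz' hlt ht).not_ge mix_le

end IsOptimalBundle

lemma _root_.IsQuasiDemand.isOptimalBundle_flat (h : IsQuasiDemand u (fun _ => B) p w z)
    (hu : ContinuousOn u (Set.Ici 0)) (hp : 0 ≤ p) (hw : 0 < w) :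
    IsOptimalBundle (fun z => u fun c => min (z c) B) p w z := by
  refine ⟨h.1.1, h.2.1, fun z' hz' hcost => ?_⟩
  simp only [fun c => min_eq_left (h.1.2 c)]
  have hB : 0 ≤ B := (h.1.1 none).trans (h.1.2 none)
  refine h.le_of_cost_le hu hw ⟨fun c => le_min (hz' c) hB, fun c => min_le_right _ _⟩
    (le_trans ?_ hcost)
  exact dotProduct_le_dotProduct_of_nonneg_left (fun c => min_le_left (z' c) B) hp

end Bundles

section Sales

variable {A J : Type*} {S : J → Type*}

lemma available_nonneg {y : A → Option J → ℝ} (hy : 0 ≤ y) (j : J) (k : A ⊕ S j) :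
    0 ≤ available y j k := by
  rcases k with i | _
  · exact hy i (some j)
  · exact zero_le_one

variable [Fintype A] [∀ j, Fintype (S j)]

lemma available_le_totalAvailable {y : A → Option J → ℝ} (hy : 0 ≤ y) (j : J) (k : A ⊕ S j) :
    available y j k ≤ totalAvailable S y j :=
  Finset.single_le_sum (fun k _ => available_nonneg hy j k) (Finset.mem_univ k)

lemma one_le_totalAvailable {y : A → Option J → ℝ} (hy : 0 ≤ y) (j : J) [Nonempty (S j)] :
    1 ≤ totalAvailable S y j :=
  available_le_totalAvailable hy j (Sum.inr (Classical.arbitrary (S j)))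

lemma sold_some (e : MarketState A J S) (j : J) :
    sold e (some j) = ∑ k : A ⊕ S j, excessSupply e j k +
      ∑ k : A ⊕ S j, ∑ i, e.detail i j k :=
  Finset.sum_add_distrib

variable [Fintype J] {m : DigitalMarket A J S} {e : MarketState A J S} {M : ℝ}

lemma sum_min_residual (m : DigitalMarket A J S) {y : A → Option J → ℝ} (hy : 0 ≤ y) (i : A)
    (j : J) {q : ℝ} (hq : 0 ≤ q) :
    ∑ k : A ⊕ S j, min (available y j k) (m.residual y i j q k) =
      min q (totalAvailable S y j) := by
  have := m.prefers_total i j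
  exact sum_min_max_zero_sub_sum (m.prefers i j) (available_nonneg (S := S) hy j) hq

lemma sum_earnings (m : DigitalMarket A J S) (e : MarketState A J S) :
    ∑ i, m.earnings e i = e.price none * sold e none +
      ∑ j, e.price (some j) * ∑ k : A ⊕ S j, ∑ i, e.detail i j k := by
  simp only [earnings, ownedSales, sold, Finset.sum_add_distrib, Fintype.sum_sum_type]
  rw [Finset.mul_sum, Finset.sum_comm]
  congr 1
  refine Finset.sum_congr rfl fun j _ => ?_
  rw [← Finset.mul_sum, Finset.sum_add_distrib,
    Finset.sum_fiberwise Finset.univ (m.owner j) fun k => ∑ b, e.detail b j (Sum.inr k), add_comm]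

lemma IsSupplyBound.pos [Nonempty A] (hM : m.IsSupplyBound M) : 0 < M := by
  choose y hy hpos using m.feasible_bread
  exact (Finset.sum_pos (fun i _ => hpos i) Finset.univ_nonempty).trans_le (hM y hy).1

/-- The states with feasible productions in which the songs are taken in the order of the rankings
of the agents, whatever quantities they ask for. -/
structure IsGreedy (m : DigitalMarket A J S) (e : MarketState A J S) : Prop where
  production_mem : ∀ i, e.production i ∈ m.feasible i
  amount_nonneg : 0 ≤ e.amount
  detail_eq : ∀ i j k, e.detail i j k =
    min (available e.production j k) (m.residual e.production i j (e.amount i (some j)) k)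

namespace IsGreedy

lemma production_nonneg (h : m.IsGreedy e) : 0 ≤ e.production :=
  fun i => m.feasible_nonneg i _ (h.production_mem i)

lemma detail_nonneg (h : m.IsGreedy e) (i : A) (j : J) (k : A ⊕ S j) : 0 ≤ e.detail i j k := by
  rw [h.detail_eq]
  exact le_min (available_nonneg h.production_nonneg j k) (le_max_left _ _)

lemma detail_le (h : m.IsGreedy e) (i : A) (j : J) (k : A ⊕ S j) :
    e.detail i j k ≤ available e.production j k := by
  rw [h.detail_eq]
  exact min_le_left _ _

lemma sum_detail (h : m.IsGreedy e) (i : A) (j : J) :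
    ∑ k, e.detail i j k = min (e.amount i (some j)) (totalAvailable S e.production j) := by
  simp only [h.detail_eq]
  exact m.sum_min_residual h.production_nonneg i j (h.amount_nonneg i (some j))

lemma sum_sum_detail (h : m.IsGreedy e) {j : J}
    (hle : ∀ i, e.amount i (some j) ≤ totalAvailable S e.production j) :
    ∑ k, ∑ i, e.detail i j k = bought e (some j) := by
  rw [Finset.sum_comm]
  exact Finset.sum_congr rfl fun i _ => by rw [h.sum_detail, min_eq_left (hle i)]

lemma sold_none_nonneg (h : m.IsGreedy e) : 0 ≤ sold e none :=
  Finset.sum_nonneg fun i _ => h.production_nonneg i none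

lemma bought_nonneg (h : m.IsGreedy e) (c : Option J) : 0 ≤ bought e c :=
  Finset.sum_nonneg fun i _ => h.amount_nonneg i c

lemma production_le (h : m.IsGreedy e) (hM : m.IsSupplyBound M) (i : A) (c : Option J) :
    e.production i c ≤ M := by
  have hy := h.production_nonneg
  rcases c with - | j
  · exact (Finset.single_le_sum (f := fun i => e.production i none) (fun i _ => hy i none)
      (Finset.mem_univ i)).trans (hM _ h.production_mem).1
  · exact (available_le_totalAvailable (S := S) hy j (Sum.inl i)).trans
      ((hM _ h.production_mem).2 j)

lemma amount_le (h : m.IsGreedy e) (hM : m.IsSupplyBound M) (hbread : bought e none ≤ sold e none)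
    (hle : ∀ i j, e.amount i (some j) ≤ totalAvailable S e.production j) (i : A) (c : Option J) :
    e.amount i c ≤ M := by
  rcases c with - | j
  · exact ((Finset.single_le_sum (f := fun i => e.amount i none)
      (fun i _ => h.amount_nonneg i none) (Finset.mem_univ i)).trans hbread).trans
      (hM _ h.production_mem).1
  · exact (hle i j).trans ((hM _ h.production_mem).2 j)

variable [Nonempty A]

lemma mem_domain (h : m.IsGreedy e) (hp : e.price ∈ stdSimplex ℝ (Option J))
    (hM : m.IsSupplyBound M) (hz : ∀ i c, e.amount i c ≤ 1.1 * M) : e ∈ domain S M := by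
  have hM_le : M ≤ 1.1 * M := by linarith [hM.pos]
  have hy := h.production_nonneg
  refine ⟨hp, fun i c => ⟨h.amount_nonneg i c, hz i c⟩,
    fun i j k => ⟨h.detail_nonneg i j k, ?_⟩,
    fun i c => ⟨hy i c, (h.production_le hM i c).trans hM_le⟩⟩
  calc e.detail i j k ≤ totalAvailable S e.production j :=
        (h.detail_le i j k).trans (available_le_totalAvailable hy j k)
    _ ≤ 1.1 * M := ((hM _ h.production_mem).2 j).trans hM_le

lemma excessSupply_nonneg (h : m.IsGreedy e) (j : J) (k : A ⊕ S j) : 0 ≤ excessSupply e j k :=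
  sub_nonneg.2 (ciSup_le fun i => h.detail_le i j k)

lemma excessSupply_eq_zero_iff (h : m.IsGreedy e) (j : J) (k : A ⊕ S j) :
    excessSupply e j k = 0 ↔ ∃ i, e.detail i j k = available e.production j k := by
  constructor
  · intro h0
    obtain ⟨i, hi⟩ := exists_eq_ciSup_of_finite (f := fun i => e.detail i j k)
    exact ⟨i, hi.trans (sub_eq_zero.1 h0).symm⟩
  · rintro ⟨i, hi⟩
    refine le_antisymm (sub_nonpos.2 ?_) (h.excessSupply_nonneg j k)
    rw [← hi]
    exact le_ciSup (f := fun i => e.detail i j k) (Set.finite_range _).bddAbove i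

lemma totalAvailable_le_sold (h : m.IsGreedy e) (j : J) :
    totalAvailable S e.production j ≤ sold e (some j) := by
  refine Finset.sum_le_sum fun k _ => ?_
  have sup_le_sum : ⨆ i, e.detail i j k ≤ ∑ i, e.detail i j k := ciSup_le fun i =>
    Finset.single_le_sum (f := fun i => e.detail i j k) (fun i _ => h.detail_nonneg i j k)
      (Finset.mem_univ i)
  simp only [excessSupply]
  linarith

lemma sold_some_pos (h : m.IsGreedy e) (j : J) [Nonempty (S j)] : 0 < sold e (some j) :=
  one_pos.trans_le
    ((one_le_totalAvailable h.production_nonneg j).trans (h.totalAvailable_le_sold j))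

end IsGreedy

/-- The greedy states with normalized prices in which no agent spends more than she earns. -/
structure IsBudgetFeasible (m : DigitalMarket A J S) (e : MarketState A J S) : Prop
    extends m.IsGreedy e where
  price_mem : e.price ∈ stdSimplex ℝ (Option J)
  budget : ∀ i, ∑ c, e.price c * e.amount i c ≤ m.earnings e i

lemma isBudgetFeasible_of_optimal {u : A → (Option J → ℝ) → ℝ}
    (hp : e.price ∈ stdSimplex ℝ (Option J))
    (hprod : ∀ i, m.IsOptimalProduction e i (e.production i))
    (hopt : ∀ i, m.IsOptimalDetailed (u i) e.price (m.earnings e i) e.production i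
      (e.amount i) (e.detail i)) : m.IsBudgetFeasible e where
  production_mem i := (hprod i).1
  amount_nonneg i := (hopt i).1.1
  detail_eq i := (hopt i).2
  price_mem := hp
  budget i := (hopt i).1.2.1

/-- The coefficients of `priceObjective`: demand over supply, with `1` added to both for bread. -/
noncomputable def demandRatio (e : MarketState A J S) : Option J → ℝ
  | none => (bought e none + 1) / (sold e none + 1)
  | some j => bought e (some j) / sold e (some j)

lemma priceObjective_eq_dotProduct (e : MarketState A J S) :
    priceObjective e = (· ⬝ᵥ demandRatio e) := by
  ext q
  exact (Fintype.sum_option fun c => q c * demandRatio e c).symm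

lemma IsGreedy.demandRatio_none_pos (h : m.IsGreedy e) : 0 < demandRatio e none :=
  div_pos (add_pos_of_nonneg_of_pos (h.bought_nonneg none) one_pos)
    (add_pos_of_nonneg_of_pos h.sold_none_nonneg one_pos)

section Ratios

variable [Nonempty A] [∀ j, Nonempty (S j)]

lemma IsGreedy.demandRatio_le_one_iff (h : m.IsGreedy e) (c : Option J) :
    demandRatio e c ≤ 1 ↔ bought e c ≤ sold e c := by
  rcases c with - | j
  · rw [demandRatio, div_le_one (add_pos_of_nonneg_of_pos h.sold_none_nonneg one_pos),
      add_le_add_iff_right]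
  · exact div_le_one (h.sold_some_pos j)

lemma IsGreedy.demandRatio_eq_one_iff (h : m.IsGreedy e) (c : Option J) :
    demandRatio e c = 1 ↔ bought e c = sold e c := by
  rcases c with - | j
  · rw [demandRatio, div_eq_one_iff_eq (add_pos_of_nonneg_of_pos h.sold_none_nonneg one_pos).ne',
      add_left_inj]
  · exact div_eq_one_iff_eq (h.sold_some_pos j).ne'

end Ratios

namespace IsBudgetFeasible

lemma price_dotProduct_bought_le (h : m.IsBudgetFeasible e) :
    e.price ⬝ᵥ bought e ≤ ∑ i, m.earnings e i := by
  simp only [dotProduct, bought, Finset.mul_sum]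
  rw [Finset.sum_comm]
  exact Finset.sum_le_sum fun i _ => h.budget i

lemma sum_earnings_of_amount_le (h : m.IsBudgetFeasible e)
    (hle : ∀ i j, e.amount i (some j) ≤ totalAvailable S e.production j) :
    ∑ i, m.earnings e i =
      e.price none * sold e none + ∑ j, e.price (some j) * bought e (some j) := by
  simp only [sum_earnings, fun j => h.sum_sum_detail fun i => hle i j]

variable [Nonempty A]

lemma price_dotProduct_bought_le_sold (h : m.IsBudgetFeasible e) :
    e.price ⬝ᵥ bought e ≤ e.price ⬝ᵥ sold e := by
  refine h.price_dotProduct_bought_le.trans ?_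
  rw [sum_earnings, dotProduct, Fintype.sum_option]
  gcongr with j
  · exact h.price_mem.1 _
  · rw [sold_some]
    exact le_add_of_nonneg_left (Finset.sum_nonneg fun k _ => h.excessSupply_nonneg j k)

variable [∀ j, Nonempty (S j)]

lemma bought_le_sold (h : m.IsBudgetFeasible e)
    (hmax : IsMaxOn (priceObjective e) (stdSimplex ℝ (Option J)) e.price) (c : Option J) :
    bought e c ≤ sold e c := by
  rw [priceObjective_eq_dotProduct] at hmax
  rw [← h.demandRatio_le_one_iff]
  refine (le_dotProduct_of_isMaxOn_stdSimplex hmax c).trans ?_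
  by_contra! hlt
  have sold_lt_bought : ∀ c, 0 < e.price c → sold e c < bought e c := by
    intro c hc
    rwa [← not_le, ← h.demandRatio_le_one_iff,
      eq_dotProduct_of_isMaxOn_stdSimplex h.price_mem hmax hc, not_le]
  obtain ⟨c₀, hc₀⟩ := exists_pos_of_mem_stdSimplex h.price_mem
  refine h.price_dotProduct_bought_le_sold.not_gt (Finset.sum_lt_sum (fun c _ => ?_)
    ⟨c₀, Finset.mem_univ _, mul_lt_mul_of_pos_left (sold_lt_bought c₀ hc₀) hc₀⟩)
  rcases (h.price_mem.1 c).eq_or_lt with h0 | h0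
  · rw [← h0, zero_mul, zero_mul]
  · exact mul_le_mul_of_nonneg_left (sold_lt_bought c h0).le h0.le

/-- An agent asking for more songs than there are takes every source completely. Then nothing is in
excess supply, so that a fictitious market maker has nothing to make up for the excess demand. -/
lemma amount_le_totalAvailable (h : m.IsBudgetFeasible e)
    (hmax : IsMaxOn (priceObjective e) (stdSimplex ℝ (Option J)) e.price) (i : A) (j : J) :
    e.amount i (some j) ≤ totalAvailable S e.production j := by
  by_contra! hlt
  have sum_eq : ∑ k, e.detail i j k = totalAvailable S e.production j := by
    rw [h.sum_detail, min_eq_right hlt.le]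
  have takes_all := (Finset.sum_eq_sum_iff_of_le fun k _ => h.detail_le i j k).1 sum_eq
  have no_excess : ∀ k, excessSupply e j k = 0 := fun k =>
    (h.excessSupply_eq_zero_iff j k).2 ⟨i, takes_all k (Finset.mem_univ k)⟩
  refine (h.bought_le_sold hmax (some j)).not_gt ?_
  rw [sold_some, Finset.sum_eq_zero fun k _ => no_excess k, zero_add, Finset.sum_comm]
  refine Finset.sum_lt_sum (fun i _ => ?_) ⟨i, Finset.mem_univ i, sum_eq.trans_lt hlt⟩
  rw [h.sum_detail]
  exact min_le_left _ _

lemma marketClears (h : m.IsBudgetFeasible e)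
    (hmax : IsMaxOn (priceObjective e) (stdSimplex ℝ (Option J)) e.price)
    (hpos : ∀ c, 0 < e.price c)
    (hbudget : ∀ i, ∑ c, e.price c * e.amount i c = m.earnings e i) : MarketClears e := by
  have hle := h.amount_le_totalAvailable hmax
  have spent_eq : e.price ⬝ᵥ bought e = ∑ i, m.earnings e i := by
    simp only [dotProduct, bought, Finset.mul_sum]
    rw [Finset.sum_comm]
    exact Finset.sum_congr rfl fun i _ => hbudget i
  have bread_clears : bought e none = sold e none := by
    rw [h.sum_earnings_of_amount_le hle, dotProduct, Fintype.sum_option, add_left_inj] at spent_eq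
    exact mul_left_cancel₀ (hpos none).ne' spent_eq
  refine ⟨bread_clears, fun j _ k => ?_, hle⟩
  rw [priceObjective_eq_dotProduct] at hmax
  have ratio_eq : demandRatio e (some j) = demandRatio e none :=
    (eq_dotProduct_of_isMaxOn_stdSimplex h.price_mem hmax (hpos _)).trans
      (eq_dotProduct_of_isMaxOn_stdSimplex h.price_mem hmax (hpos _)).symm
  rw [(h.demandRatio_eq_one_iff none).2 bread_clears, h.demandRatio_eq_one_iff, sold_some,
    h.sum_sum_detail fun i => hle i j, right_eq_add] at ratio_eq
  exact (h.excessSupply_eq_zero_iff j k).1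
    ((Finset.sum_eq_zero_iff_of_nonneg fun k _ => h.excessSupply_nonneg j k).1 ratio_eq k
      (Finset.mem_univ k))

lemma isMaxOn_priceObjective (h : m.IsBudgetFeasible e) (hclear : MarketClears e)
    (hpos : ∀ c, 0 < e.price c) :
    IsMaxOn (priceObjective e) (stdSimplex ℝ (Option J)) e.price := by
  obtain ⟨bread_clears, sources_exhausted, hle⟩ := hclear
  have ratio_eq_one : demandRatio e = 1 := by
    funext c
    refine (h.demandRatio_eq_one_iff c).2 ?_
    rcases c with - | j
    · exact bread_clears
    · rw [sold_some, h.sum_sum_detail fun i => hle i j, Finset.sum_eq_zero fun k _ =>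
        (h.excessSupply_eq_zero_iff j k).2 (sources_exhausted j (hpos _) k), zero_add]
  intro q hq
  simp only [priceObjective_eq_dotProduct, ratio_eq_one, dotProduct_one, hq.2, h.price_mem.2,
    Set.mem_ofPred_eq, le_refl]

lemma exists_earnings_pos (h : m.IsBudgetFeasible e)
    (hmax : IsMaxOn (priceObjective e) (stdSimplex ℝ (Option J)) e.price)
    (hnone : e.price none = 0) : ∃ i, 0 < m.earnings e i := by
  have sum_eq := h.sum_earnings_of_amount_le (h.amount_le_totalAvailable hmax)
  rw [hnone, zero_mul, zero_add] at sum_eq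
  rw [priceObjective_eq_dotProduct] at hmax
  obtain ⟨c, hc⟩ := exists_pos_of_mem_stdSimplex h.price_mem
  obtain ⟨j, rfl⟩ := Option.ne_none_iff_exists'.1 fun hcn : c = none => (hcn ▸ hc).ne' hnone
  have ratio_pos : 0 < demandRatio e (some j) := by
    rw [eq_dotProduct_of_isMaxOn_stdSimplex h.price_mem hmax hc]
    exact h.demandRatio_none_pos.trans_le (le_dotProduct_of_isMaxOn_stdSimplex hmax none)
  have bought_pos : 0 < bought e (some j) :=
    (div_pos_iff_of_pos_right (h.sold_some_pos j)).1 ratio_pos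
  have sum_pos : ∑ _i : A, (0 : ℝ) < ∑ i, m.earnings e i := by
    rw [sum_eq, Finset.sum_const_zero]
    exact Finset.sum_pos' (fun j _ => mul_nonneg (h.price_mem.1 _) (h.bought_nonneg _))
      ⟨j, Finset.mem_univ j, mul_pos hc bought_pos⟩
  obtain ⟨i, -, hi⟩ := Finset.exists_lt_of_sum_lt sum_pos
  exact ⟨i, hi⟩

end IsBudgetFeasible

end Sales

section FixedPoints

variable {A J : Type*} {S : J → Type*} [Fintype A] [Fintype J] [∀ j, Fintype (S j)]
  [Nonempty A] [∀ j, Nonempty (S j)] {m : DigitalMarket A J S} {e : MarketState A J S} {M : ℝ}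

lemma isEquilibrium_of_mem_correspondence (hM : m.IsSupplyBound M)
    (he : e ∈ m.correspondence M e) : m.IsEquilibrium e := by
  obtain ⟨hdom, hopt, hprod, hmax⟩ := he
  have h : m.IsBudgetFeasible e := isBudgetFeasible_of_optimal hdom.1 hprod hopt
  have below_cap : ∀ i c, e.amount i c < 1.1 * M := fun i c => by
    linarith [hM.pos, h.amount_le hM (h.bought_le_sold hmax none)
      (h.amount_le_totalAvailable hmax) i c]
  have bundle_optimal : ∀ i, IsOptimalBundle (m.utility i) e.price (m.earnings e i) (e.amount i) :=
    fun i => (hopt i).1.of_flat (below_cap i) (m.utility_continuous i)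
      (m.utility_quasiconcave i) (m.utility_nonsatiated i)
  exact
    { price_nonneg := hdom.1.1
      optimal_production := hprod
      optimal_allocation := fun i => ⟨bundle_optimal i, (hopt i).2⟩
      clears := h.marketClears hmax
        ((bundle_optimal (Classical.arbitrary A)).price_pos (m.utility_nonsatiated _))
        fun i => (bundle_optimal i).budget_eq (m.utility_nonsatiated i) }

lemma IsEquilibrium.mem_correspondence (h : m.IsEquilibrium e) (hM : m.IsSupplyBound M)
    (hp : e.price ∈ stdSimplex ℝ (Option J)) : e ∈ m.correspondence M e := by
  have hb : m.IsBudgetFeasible e :=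
    isBudgetFeasible_of_optimal hp h.optimal_production h.optimal_allocation
  have hM0 := hM.pos
  have hle : ∀ i c, e.amount i c ≤ 1.1 * M := fun i c => by
    linarith [hb.amount_le hM h.clears.1.le h.clears.2.2 i c]
  refine ⟨hb.mem_domain hp hM hle, fun i => ⟨?_, (h.optimal_allocation i).2⟩,
    h.optimal_production, hb.isMaxOn_priceObjective h.clears
      ((h.optimal_allocation (Classical.arbitrary A)).1.price_pos (m.utility_nonsatiated _))⟩
  exact (h.optimal_allocation i).1.flat hp.1 (by positivity) (hle i)

theorem mem_correspondence_iff (hM : m.IsSupplyBound M) :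
    e ∈ m.correspondence M e ↔ e.price ∈ stdSimplex ℝ (Option J) ∧ m.IsEquilibrium e :=
  ⟨fun he => ⟨he.1.1, isEquilibrium_of_mem_correspondence hM he⟩,
    fun h => h.2.mem_correspondence hM h.1⟩

end FixedPoints

section PotentialEarnings

variable {A J : Type*} {S : J → Type*} [Fintype A] [Fintype J] [∀ j, Fintype (S j)]
  {m : DigitalMarket A J S} {e : MarketState A J S}

lemma concaveOn_potentialEarnings (m : DigitalMarket A J S) (hp : 0 ≤ e.price) (i : A) :
    ConcaveOn ℝ Set.univ (m.potentialEarnings e i) := by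
  have coordinate : ∀ c, ConcaveOn ℝ Set.univ fun v : Option J → ℝ => v c := fun c =>
    (LinearMap.proj (R := ℝ) (φ := fun _ : Option J => ℝ) c).concaveOn convex_univ
  refine ((coordinate none).smul (hp none)).add (concaveOn_finsetSum convex_univ fun j _ => ?_)
  refine ConcaveOn.smul (hp (some j)) ((concaveOn_const _ convex_univ).add ?_)
  exact concaveOn_finsetSum convex_univ fun b _ =>
    (coordinate (some j)).inf (concaveOn_const _ convex_univ)

namespace IsGreedy

lemma potentialEarnings_production (h : m.IsGreedy e) (i : A) :
    m.potentialEarnings e i (e.production i) = m.earnings e i := by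
  simp only [potentialEarnings, earnings, h.detail_eq _ _ (Sum.inl i), available]

lemma price_mul_le_potentialEarnings (h : m.IsGreedy e) (hp : 0 ≤ e.price) (i : A)
    {v : Option J → ℝ} (hv : 0 ≤ v) : e.price none * v none ≤ m.potentialEarnings e i v := by
  refine le_add_of_nonneg_right (Finset.sum_nonneg fun j _ => mul_nonneg (hp _) (add_nonneg ?_ ?_))
  · exact Finset.sum_nonneg fun k _ => Finset.sum_nonneg fun b _ => h.detail_nonneg b j _
  · exact Finset.sum_nonneg fun b _ => le_min (hv _) (le_max_left _ _)

lemma earnings_nonneg (h : m.IsGreedy e) (hp : 0 ≤ e.price) (i : A) : 0 ≤ m.earnings e i := by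
  rw [← h.potentialEarnings_production]
  exact (mul_nonneg (hp none) (h.production_nonneg i none)).trans
    (h.price_mul_le_potentialEarnings hp i (h.production_nonneg i))

lemma earnings_pos (h : m.IsGreedy e) (hp : 0 ≤ e.price) (hnone : 0 < e.price none) {i : A}
    (hopt : m.IsOptimalProduction e i (e.production i)) : 0 < m.earnings e i := by
  obtain ⟨v, hv, v_pos⟩ := m.feasible_bread i
  calc 0 < e.price none * v none := mul_pos hnone v_pos
    _ ≤ m.potentialEarnings e i v :=
      h.price_mul_le_potentialEarnings hp i (m.feasible_nonneg i v hv)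
    _ ≤ m.potentialEarnings e i (e.production i) := hopt.2 v hv
    _ = m.earnings e i := h.potentialEarnings_production i

end IsGreedy

end PotentialEarnings

section CoarseStates

variable {A J : Type*} {S : J → Type*}

/-- Prices, coarse allocations and productions. Unlike the space of market states, this is a real
vector space, and it does not contain the details, which are determined by the coarse data but do
not form convex sets. -/
abbrev CoarseState (A J : Type*) : Type _ :=
  (Option J → ℝ) × (A → Option J → ℝ) × (A → Option J → ℝ)

lemma continuous_available (j : J) (k : A ⊕ S j) :
    Continuous fun q : CoarseState A J => available q.2.2 j k := by
  rcases k with i | _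
  · simp only [available]
    fun_prop
  · exact continuous_const

variable [Fintype A] [Fintype J] (m : DigitalMarket A J S) {B : ℝ} {q : CoarseState A J}

/-- The compact convex set on which equilibria are sought: normalized prices, allocations of at most
`B` units of each good, and feasible productions. -/
def coarseDomain (B : ℝ) : Set (CoarseState A J) :=
  stdSimplex ℝ (Option J) ×ˢ
    (Set.univ.pi fun _ => Set.Icc 0 fun _ => B) ×ˢ Set.univ.pi m.feasible

lemma isCompact_coarseDomain (B : ℝ) : IsCompact (m.coarseDomain B) :=
  (isCompact_stdSimplex ℝ _).prod ((isCompact_univ_pi fun _ => isCompact_Icc).prod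
    (isCompact_univ_pi m.feasible_compact))

lemma convex_coarseDomain (B : ℝ) : Convex ℝ (m.coarseDomain B) :=
  (convex_stdSimplex ℝ _).prod ((convex_pi fun _ _ => convex_Icc _ _).prod
    (convex_pi fun i _ => m.feasible_convex i))

lemma coarseDomain_nonempty (hB : 0 ≤ B) : (m.coarseDomain B).Nonempty := by
  choose y hy _ using m.feasible_bread
  exact ⟨(Pi.single none 1, 0, y), single_mem_stdSimplex ℝ none,
    fun _ _ => ⟨le_rfl, fun _ => hB⟩, fun i _ => hy i⟩

variable [∀ j, Fintype (S j)]

lemma exists_isSupplyBound : ∃ M, m.IsSupplyBound M := by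
  have production_bounded : ∀ i, ∃ B, ∀ y ∈ m.feasible i, ∀ c, y c ≤ B := by
    intro i
    obtain ⟨B, hB⟩ := (m.feasible_compact i).isBounded.exists_norm_le
    exact ⟨B, fun y hy c => (le_abs_self _).trans ((norm_le_pi_norm y c).trans (hB y hy))⟩
  choose B hB using production_bounded
  refine ⟨∑ i, B i + ∑ j, (Fintype.card (S j) : ℝ), fun y hy => ⟨?_, fun j => ?_⟩⟩
  · exact le_add_of_le_of_nonneg (Finset.sum_le_sum fun i _ => hB i _ (hy i) none)
      (Finset.sum_nonneg fun j _ => Nat.cast_nonneg _)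
  · rw [totalAvailable, Fintype.sum_sum_type]
    refine add_le_add (Finset.sum_le_sum fun i _ => hB i _ (hy i) (some j)) ?_
    simpa only [available, Finset.sum_const, Finset.card_univ, nsmul_eq_mul, mul_one] using
      Finset.single_le_sum (f := fun j => (Fintype.card (S j) : ℝ))
        (fun j _ => Nat.cast_nonneg _) (Finset.mem_univ j)

/-- The state in which the details of a coarse allocation follow the rankings. -/
noncomputable def greedyState (q : CoarseState A J) : MarketState A J S where
  price := q.1
  amount := q.2.1
  detail i j k := min (available q.2.2 j k) (m.residual q.2.2 i j (q.2.1 i (some j)) k)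
  production := q.2.2

variable {m} in
lemma isGreedy_greedyState (hq : q ∈ m.coarseDomain B) : m.IsGreedy (m.greedyState q) where
  production_mem i := hq.2.2 i trivial
  amount_nonneg i := (hq.2.1 i trivial).1
  detail_eq _ _ _ := rfl

lemma continuous_residual (i : A) (j : J) (k : A ⊕ S j) :
    Continuous fun q : CoarseState A J => m.residual q.2.2 i j (q.2.1 i (some j)) k := by
  have := continuous_available (A := A) (S := S) j
  simp only [residual]
  fun_prop

lemma continuous_detail (i : A) (j : J) (k : A ⊕ S j) :
    Continuous fun q : CoarseState A J => (m.greedyState q).detail i j k :=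
  (continuous_available j k).min (m.continuous_residual i j k)

lemma continuous_earnings (i : A) :
    Continuous fun q : CoarseState A J => m.earnings (m.greedyState q) i := by
  have := m.continuous_detail
  simp only [earnings, ownedSales]
  simp only [greedyState] at this ⊢
  fun_prop

lemma continuous_potentialEarnings (i : A) :
    Continuous fun r : CoarseState A J × (Option J → ℝ) =>
      m.potentialEarnings (m.greedyState r.1) i r.2 := by
  have detail_fst := fun i j k => (m.continuous_detail i j k).comp
    (continuous_fst (X := CoarseState A J) (Y := Option J → ℝ))
  have residual_fst := fun i j k => (m.continuous_residual i j k).comp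
    (continuous_fst (X := CoarseState A J) (Y := Option J → ℝ))
  simp only [Function.comp_def] at detail_fst residual_fst
  simp only [potentialEarnings, ownedSales]
  simp only [greedyState] at detail_fst ⊢
  fun_prop

lemma continuous_bought (c : Option J) :
    Continuous fun q : CoarseState A J => bought (m.greedyState q) c := by
  simp only [bought, greedyState]
  fun_prop

variable [Nonempty A]

lemma continuous_excessSupply (j : J) (k : A ⊕ S j) :
    Continuous fun q : CoarseState A J => excessSupply (m.greedyState q) j k := by
  refine (continuous_available j k).sub ?_
  simp only [← Finset.sup'_univ_eq_ciSup]
  exact Continuous.finset_sup'_apply _ fun i _ => m.continuous_detail i j k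

lemma continuous_sold (c : Option J) :
    Continuous fun q : CoarseState A J => sold (m.greedyState q) c := by
  rcases c with - | j
  · simp only [sold, greedyState]
    fun_prop
  · have := m.continuous_detail
    have := m.continuous_excessSupply j
    simp only [sold]
    fun_prop

variable [∀ j, Nonempty (S j)]

lemma continuousOn_demandRatio (B : ℝ) :
    ContinuousOn (fun q : CoarseState A J => demandRatio (m.greedyState q))
      (m.coarseDomain B) := by
  refine continuousOn_pi.2 fun c => ?_
  have hb := (m.continuous_bought c).continuousOn (s := m.coarseDomain B)
  have hs := (m.continuous_sold c).continuousOn (s := m.coarseDomain B)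
  rcases c with - | j
  · refine (hb.add continuousOn_const).div (hs.add continuousOn_const) fun q hq => ?_
    exact (add_pos_of_nonneg_of_pos (isGreedy_greedyState hq).sold_none_nonneg one_pos).ne'
  · exact hb.div hs fun q hq => ((isGreedy_greedyState hq).sold_some_pos j).ne'

end CoarseStates

section Response

variable {A J : Type*} {S : J → Type*} [Fintype A] [Fintype J] [∀ j, Fintype (S j)]
  (m : DigitalMarket A J S) {B M : ℝ} {q : CoarseState A J}

/-- The responses to a coarse state: prices that maximize the objective, quasi-demands of the agents
and optimal productions. Demands would not have a closed graph where earnings vanish. -/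
def coarseResponse (B : ℝ) (q : CoarseState A J) : Set (CoarseState A J) :=
  {p | p ∈ stdSimplex ℝ (Option J) ∧
      IsMaxOn (priceObjective (m.greedyState q)) (stdSimplex ℝ (Option J)) p} ×ˢ
    (Set.univ.pi fun i => {z | IsQuasiDemand (m.utility i) (fun _ => B) q.1
      (m.earnings (m.greedyState q) i) z}) ×ˢ
    Set.univ.pi fun i => {v | m.IsOptimalProduction (m.greedyState q) i v}

lemma coarseResponse_subset (B : ℝ) (q : CoarseState A J) :
    m.coarseResponse B q ⊆ m.coarseDomain B :=
  fun _ hr => ⟨hr.1.1, fun i _ => (hr.2.1 i trivial).1, fun i _ => (hr.2.2 i trivial).1⟩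

lemma convex_coarseResponse (hp : 0 ≤ q.1) : Convex ℝ (m.coarseResponse B q) := by
  refine Convex.prod ?_ (Convex.prod (convex_pi fun i _ => ?_) (convex_pi fun i _ => ?_))
  · have objective_concave : ConcaveOn ℝ (stdSimplex ℝ (Option J))
        (priceObjective (m.greedyState q)) := by
      rw [priceObjective_eq_dotProduct]
      exact (IsLinearMap.mk' (· ⬝ᵥ demandRatio (m.greedyState q))
        ⟨fun p p' => add_dotProduct p p' _, fun c p => smul_dotProduct c p _⟩).concaveOn
          (convex_stdSimplex ℝ _)
    exact convex_setOf_isMaxOn objective_concave.quasiconcaveOn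
  · exact convex_setOf_isQuasiDemand (m.utility_quasiconcave i) _ _ _
  · exact convex_setOf_isMaxOn (((m.concaveOn_potentialEarnings (e := m.greedyState q) hp i).subset
      (Set.subset_univ _) (m.feasible_convex i)).quasiconcaveOn)

lemma coarseResponse_nonempty (hq : q ∈ m.coarseDomain B) (hB : 0 ≤ B) :
    (m.coarseResponse B q).Nonempty := by
  have objective_continuous : Continuous (priceObjective (m.greedyState q)) := by
    simp only [priceObjective_eq_dotProduct, dotProduct]
    fun_prop
  obtain ⟨p, hp⟩ := (isCompact_stdSimplex ℝ (Option J)).exists_isMaxOn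
    ⟨_, single_mem_stdSimplex ℝ none⟩ objective_continuous.continuousOn
  have exists_demand := fun i => exists_isQuasiDemand (b := fun _ => B) (m.utility_continuous i)
    (fun _ => hB) q.1 ((isGreedy_greedyState hq).earnings_nonneg hq.1.1 i)
  have exists_production : ∀ i, ∃ v, m.IsOptimalProduction (m.greedyState q) i v := by
    intro i
    obtain ⟨y, hy, -⟩ := m.feasible_bread i
    exact (m.feasible_compact i).exists_isMaxOn ⟨y, hy⟩
      ((m.continuous_potentialEarnings i).comp (Continuous.prodMk_right q)).continuousOn
  choose x hx using exists_demand
  choose y hy using exists_production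
  exact ⟨(p, x, y), hp, fun i _ => hx i, fun i _ => hy i⟩

variable {m} in
lemma isBudgetFeasible_greedyState (hq : q ∈ m.coarseResponse B q) :
    m.IsBudgetFeasible (m.greedyState q) where
  toIsGreedy := isGreedy_greedyState (m.coarseResponse_subset B q hq)
  price_mem := hq.1.1
  budget i := (hq.2.1 i trivial).2.1

variable [Nonempty A] [∀ j, Nonempty (S j)]

lemma isClosed_graph_coarseResponse (B : ℝ) :
    IsClosed {r : CoarseState A J × CoarseState A J |
      r.1 ∈ m.coarseDomain B ∧ r.2 ∈ m.coarseResponse B r.1} := by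
  have domain_closed := (m.isCompact_coarseDomain B).isClosed
  have prices_closed := isClosed_setOf_isMaxOn (f := fun q => priceObjective (m.greedyState q))
    domain_closed (isClosed_stdSimplex ℝ (Option J)) (by
      simp only [priceObjective_eq_dotProduct]
      exact (continuous_fst.dotProduct continuous_snd).comp_continuousOn (continuousOn_snd.prodMk
        ((m.continuousOn_demandRatio B).comp continuousOn_fst fun r hr => hr.1)))
  have demands_closed := fun i => (isClosed_setOf_isQuasiDemand (m.utility_continuous i)
    fun _ => B).preimage (f := fun r : CoarseState A J × CoarseState A J =>
      (r.1.1, m.earnings (m.greedyState r.1) i, r.2.2.1 i))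
        ((continuous_fst.comp continuous_fst).prodMk
          (((m.continuous_earnings i).comp continuous_fst).prodMk (by fun_prop)))
  have productions_closed := fun i => isClosed_setOf_isMaxOn
    (f := fun q => m.potentialEarnings (m.greedyState q) i) domain_closed
    (m.feasible_compact i).isClosed (m.continuous_potentialEarnings i).continuousOn
  convert (prices_closed.preimage (f := fun r : CoarseState A J × CoarseState A J => (r.1, r.2.1))
      (by fun_prop)).inter ((isClosed_iInter demands_closed).inter (isClosed_iInter fun i =>
      (productions_closed i).preimage
        (f := fun r : CoarseState A J × CoarseState A J => (r.1, r.2.2.2 i)) (by fun_prop)))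
    using 1
  ext r
  simp only [coarseResponse, Set.mem_prod, Set.mem_univ_pi, Set.mem_inter_iff, Set.mem_iInter,
    Set.mem_preimage, Set.mem_ofPred_eq]
  exact ⟨fun h => ⟨⟨h.1, h.2.1⟩, h.2.2.1, fun i => ⟨h.1, h.2.2.2 i⟩⟩,
    fun h => ⟨h.1.1, h.1.2, h.2.1, fun i => (h.2.2 i).2⟩⟩

variable {m}

lemma price_none_pos_of_mem_coarseResponse (hM : m.IsSupplyBound M) (hMB : M < B)
    (hq : q ∈ m.coarseResponse B q) : 0 < q.1 none := by
  have h := isBudgetFeasible_greedyState hq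
  refine (hq.1.1.1 none).lt_of_ne' fun hnone => ?_
  obtain ⟨i, hi⟩ := h.exists_earnings_pos hq.1.2 hnone
  have amount_lt : q.2.1 i none < B :=
    (h.amount_le hM (h.bought_le_sold hq.1.2 none) (h.amount_le_totalAvailable hq.1.2)
      i none).trans_lt hMB
  exact ((hq.2.1 i trivial).price_pos (m.utility_continuous i) (m.utility_nonsatiated i) hi
    amount_lt).ne' hnone

lemma greedyState_mem_correspondence (hM : m.IsSupplyBound M)
    (hq : q ∈ m.coarseResponse (1.1 * M) q) :
    m.greedyState q ∈ m.correspondence M (m.greedyState q) := by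
  have h := isBudgetFeasible_greedyState hq
  have optimal_production := fun i => hq.2.2 i trivial
  have bread_pos := price_none_pos_of_mem_coarseResponse hM (by linarith [hM.pos]) hq
  have earnings_pos := fun i => h.earnings_pos hq.1.1.1 bread_pos (optimal_production i)
  exact ⟨h.mem_domain hq.1.1 hM fun i => (hq.2.1 i trivial).1.2,
    fun i => ⟨(hq.2.1 i trivial).isOptimalBundle_flat (m.utility_continuous i) hq.1.1.1
      (earnings_pos i), h.detail_eq i⟩, optimal_production, hq.1.2⟩

theorem exists_isEquilibrium (m : DigitalMarket A J S) :
    ∃ e : MarketState A J S, e.price ∈ stdSimplex ℝ (Option J) ∧ m.IsEquilibrium e := by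
  obtain ⟨M, hM⟩ := m.exists_isSupplyBound
  have cap_nonneg : 0 ≤ 1.1 * M := by linarith [hM.pos]
  obtain ⟨q, -, hq⟩ := exists_mem_self_of_isClosed_graph (m.isCompact_coarseDomain (1.1 * M))
    (m.convex_coarseDomain _) (m.coarseDomain_nonempty cap_nonneg)
    (fun q _ => m.coarseResponse_subset _ q) (fun _ hq => m.coarseResponse_nonempty hq cap_nonneg)
    (fun _ hq => m.convex_coarseResponse hq.1.1) (m.isClosed_graph_coarseResponse _)
  exact ⟨_, (mem_correspondence_iff hM).1 (greedyState_mem_correspondence hM hq)⟩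

end Response

end DigitalMarket

theorem mainTheorem1 {A J : Type*} {S : J → Type*} [Fintype A] [Fintype J]
    [∀ j, Fintype (S j)] [Nonempty A] [∀ j, Nonempty (S j)] (m : DigitalMarket A J S) :
    (∀ M : ℝ, m.IsSupplyBound M → ∀ e : MarketState A J S,
      e ∈ m.correspondence M e ↔ e.price ∈ stdSimplex ℝ (Option J) ∧ m.IsEquilibrium e) ∧
    ∃ e : MarketState A J S, e.price ∈ stdSimplex ℝ (Option J) ∧ m.IsEquilibrium e :=
  ⟨fun _ hM _ => DigitalMarket.mem_correspondence_iff hM, m.exists_isEquilibrium⟩
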